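/- For $k \ge 0$, a $k$-dimensional permutation structure is a set equipped with $k$ (strict) linear orders $<_1, \dots, <_k$. A structure is homogeneous if every isomorphism between finite substructures extends to an automorphism, and primitive if its only $\emptyset$-definable equivalence relations are equality and the universal relation. The generic $k$-dimensional permutation structure is the Fraïssé limit of the class of all finite $k$-dimensional permutation structures. Theorem. Let $\Gamma$ be a countable set equipped with three binary relations $<_1, <_2, <_3$. Then $(\Gamma, <_1, <_2, <_3)$ is a primitive homogeneous 3-dimensional permutation structure with more than one point if and only if it is obtained from a generic structure by identifying certain orders up to reversal, that is, if and only if there are $k \in \mathbb{N}$, a surjection $\sigma : \{1,2,3\} \to \{1, \dots, k\}$ (so $1 \le k \le 3$) and linear orders $\prec_1, \dots, \prec_k$ on $\Gamma$ such that $(\Gamma, \prec_1, \dots, \prec_k)$ is a generic $k$-dimensional permutation structure and each $<_i$ is either $\prec_{\sigma(i)}$ or the reversal of $\prec_{\sigma(i)}$. Moreover, every such identification occurs: for every $k$, every surjection $\sigma : \{1,2,3\} \to \{1,\dots,k\}$ and every choice of the set of indices $i$ for which $<_i$ is to be reversed, there is a countable $\Gamma$ of this form. -/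

import Mathlib

universe u

/-- The relation symbols of the language of `n` binary relations `<₀, …, <ₙ₋₁`. -/
inductive PermRel (n : ℕ) : ℕ → Type
  | lt (i : Fin n) : PermRel n 2

/-- The relational language with `n` binary relation symbols, and no other symbol. -/
def permLang (n : ℕ) : FirstOrder.Language.{0, 0} := ⟨fun _ => Empty, PermRel n⟩

instance permLang.isRelational (n : ℕ) : (permLang n).IsRelational :=
  fun _ => inferInstanceAs (IsEmpty Empty)

/-- The `i`-th binary relation `x <ᵢ y` of a structure in the language `permLang n`. -/
def permLT {n : ℕ} {M : Type*} [(permLang n).Structure M] (i : Fin n) (x y : M) : Prop :=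
  FirstOrder.Language.Structure.RelMap (L := permLang n) (n := 2) (PermRel.lt i) ![x, y]

/-- An `n`-dimensional permutation structure: each of the `n` relations is a (strict) linear
order. -/
structure IsPermStructure (n : ℕ) (M : Type*) [(permLang n).Structure M] : Prop where
  irrefl : ∀ (i : Fin n) (x : M), ¬ permLT i x x
  trans : ∀ (i : Fin n) (x y z : M), permLT i x y → permLT i y z → permLT i x z
  total : ∀ (i : Fin n) (x y : M), x ≠ y → permLT i x y ∨ permLT i y x

/-- A structure is primitive if it has no `∅`-definable equivalence relation other than equality
and the universal relation. -/
def IsPrimitiveStructure (L : FirstOrder.Language.{0, 0}) (M : Type*) [L.Structure M] : Prop :=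
  ∀ r : Setoid M, (∅ : Set M).Definable₂ L {p : M × M | r p.1 p.2} → r = ⊥ ∨ r = ⊤

/-- The class of all finite `k`-dimensional permutation structures. -/
def finitePermStructures (k : ℕ) : Set (CategoryTheory.Bundled.{u} (permLang k).Structure) :=
  {S | Finite S ∧ IsPermStructure k S}

/-- `Γ` is the generic structure obtained after identifying some of its `n` orders up to reversal.
The identification is given by a map `σ` onto the index set `Fin k` of the orders that remain, and
by the set of those `i` for which `<ᵢ` is the reversal (`rev i = true`) of the order `<_{σ i}` with
which it is identified. The `k` remaining orders make `Γ` into a Fraïssé limit of the class of all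
finite `k`-dimensional permutation structures. -/
def IsGenericUpToIdentification {n k : ℕ} (σ : Fin n → Fin k) (rev : Fin n → Bool)
    (Γ : Type*) [Countable Γ] [(permLang n).Structure Γ] : Prop :=
  ∃ _ : (permLang k).Structure Γ,
    FirstOrder.Language.IsFraisseLimit (L := permLang k) (finitePermStructures k) Γ ∧
    ∀ (i : Fin n) (x y : Γ),
      permLT i x y ↔ if rev i = true then permLT (σ i) y x else permLT (σ i) x y

/-!
# Primitive homogeneous permutation structures with three orders

The type of a pair of distinct points is a sign vector, and each sign vector `p` defines a strict
partial order on the points: if `(x, y)` and `(y, z)` have type `p`, so has `(x, z)`. Write `p(a)`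
for the set of all `z` such that `(a, z)` has type `p`. In a homogeneous structure this set is
an orbit of the stabilizer of `a`.

The heart of the classification is that `p(a)` is cofinal in each of the orders, in the direction
given by `p` (`IsPrimitiveHomogeneous.mem_shadow_of_isRealized`). Otherwise the type with the
smallest downward closure, its *shadow*, makes the points into a semilinear order `Near`; by
primitivity any two points have a common lower bound in it. Homogeneity is contradicted by a chain
`u, v, c` of a cofinal type `d`. On the one hand `v` and `c` can be made to have a lower bound in
the semilinear order that is above `u`; on the other hand this then holds for all `c` in `d(v)`,
which therefore all lie in the shadow of a common lower bound of `u` and `v`. The type `d` is chosen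
to resemble as much as possible a type of near pairs, so that the chain can be built.

From cofinality, `p(a)` is dense on its side of `a` (`exists_hasType_between`), and each `p` is a
downwards directed partial order, so that restricting attention to `p(a)` costs nothing
(`exists_hasType_of_dense`). Hence, if some orders are jointly dense and their signs do not
determine the sign of one more order, this order can be added to them (`jointlyDense_insert`). With
three orders, the sign of a further order is determined by the signs of a jointly dense family only
if that order agrees, up to reversal, with a member of the family
(`IsPrimitiveHomogeneous.exists_sign_eq`). Finally, a countable set with jointly dense orders
without endpoints is generic, by back-and-forth (`isFraisseLimit_of_jointlyDense`).

For the converse, homogeneity passes to the identified structure because automorphisms stay the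
same, and a proper invariant equivalence relation is excluded by three-point configurations
(`eq_bot_or_eq_top_of_isFraisseLimit`). The generic structure exists: take the rational polynomials,
ordered by their values at `k` distinct transcendental numbers (`exists_jointlyDense_eval`).
-/

/-! ### Families of linear orders and their 2-types -/

section Families

variable {ι M : Type*}

/-- The `i`-th order of the family `lt` if `b = true`, and its reversal if `b = false`. -/
def DirLT (lt : ι → M → M → Prop) (i : ι) (b : Bool) (x y : M) : Prop :=
  if b then lt i x y else lt i y x

/-- The 2-type of distinct points `(x, y)` is a sign vector `p`: the sign `p i` says whether
`x <ᵢ y` or `y <ᵢ x`. -/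
def HasType (lt : ι → M → M → Prop) (p : ι → Bool) (x y : M) : Prop :=
  ∀ i, DirLT lt i (p i) x y

/-- The 2-type `p` occurs among the pairs of points. -/
def IsRealized (lt : ι → M → M → Prop) (p : ι → Bool) : Prop :=
  ∃ x y, HasType lt p x y

/-- The 2-type of the pair `(y, x)` when `(x, y)` has 2-type `p`. -/
def negType (p : ι → Bool) : ι → Bool := fun i => !p i

/-- `e` is an automorphism of the family of relations `lt`. -/
def IsAut (lt : ι → M → M → Prop) (e : M ≃ M) : Prop :=
  ∀ i x y, lt i (e x) (e y) ↔ lt i x y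

/-- A family of linear orders. -/
structure IsLinearFamily (lt : ι → M → M → Prop) : Prop where
  irrefl : ∀ i x, ¬ lt i x x
  trans : ∀ i x y z, lt i x y → lt i y z → lt i x z
  total : ∀ i x y, x ≠ y → lt i x y ∨ lt i y x

/-- Homogeneity of a family of relations, stated for finite tuples of points. -/
def IsHomogeneousFamily (lt : ι → M → M → Prop) : Prop :=
  ∀ (m : ℕ) (a b : Fin m → M), (∀ i j k, lt i (a j) (a k) ↔ lt i (b j) (b k)) →
    ∃ e : M ≃ M, IsAut lt e ∧ ∀ j, e (a j) = b j

/-- A primitive homogeneous family of linear orders on a set with at least two points. Primitivity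
is stated for automorphism-invariant equivalence relations. -/
structure IsPrimitiveHomogeneous (lt : ι → M → M → Prop) : Prop extends IsLinearFamily lt where
  homogeneous : IsHomogeneousFamily lt
  primitive : ∀ r : Setoid M, (∀ e : M ≃ M, IsAut lt e → ∀ x y, r x y → r (e x) (e y)) →
    r = ⊥ ∨ r = ⊤
  nontrivial : ∃ x y : M, x ≠ y
  nonempty_index : Nonempty ι

variable {lt : ι → M → M → Prop} {i : ι} {b c : Bool} {p q : ι → Bool} {x y z : M}

namespace IsLinearFamily

variable (h : IsLinearFamily lt)
include h

theorem dir_irrefl : ¬ DirLT lt i b x x := by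
  cases b <;> simpa [DirLT] using h.irrefl i x

theorem dir_trans (h₁ : DirLT lt i b x y) (h₂ : DirLT lt i b y z) : DirLT lt i b x z := by
  cases b
  · exact h.trans i z y x h₂ h₁
  · exact h.trans i x y z h₁ h₂

theorem dir_total (i : ι) (b : Bool) (x y : M) :
    DirLT lt i b x y ∨ x = y ∨ DirLT lt i b y x := by
  rcases eq_or_ne x y with rfl | hne
  · exact Or.inr (Or.inl rfl)
  · rcases h.total i x y hne with h' | h' <;> cases b <;> simp [DirLT, h']

theorem dir_asymm (h₁ : DirLT lt i b x y) : ¬ DirLT lt i b y x :=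
  fun h₂ => h.dir_irrefl (h.dir_trans h₁ h₂)

end IsLinearFamily

theorem dir_not : DirLT lt i (!b) x y ↔ DirLT lt i b y x := by
  cases b <;> simp [DirLT]

namespace IsLinearFamily

variable (h : IsLinearFamily lt)
include h

theorem dir_unique (h₁ : DirLT lt i b x y) (h₂ : DirLT lt i c x y) : b = c := by
  by_contra hne
  have hc : c = !b := by cases b <;> cases c <;> simp_all
  rw [hc, dir_not] at h₂
  exact h.dir_asymm h₁ h₂

theorem exists_hasType (hne : x ≠ y) : ∃ p, HasType lt p x y := by
  classical
  refine ⟨fun i => decide (lt i x y), fun i => ?_⟩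
  by_cases hi : lt i x y
  · simp [DirLT, hi]
  · simpa [DirLT, hi] using (h.total i x y hne).resolve_left hi

theorem hasType_trans (h₁ : HasType lt p x y) (h₂ : HasType lt p y z) : HasType lt p x z :=
  fun i => h.dir_trans (h₁ i) (h₂ i)

theorem lt_iff_of_dir {x' y' : M} (h₁ : DirLT lt i b x y) (h₂ : DirLT lt i b x' y') :
    (lt i x y ↔ lt i x' y') ∧ (lt i y x ↔ lt i y' x') := by
  have h₃ := h.dir_asymm h₁
  have h₄ := h.dir_asymm h₂
  cases b <;> simp only [DirLT, if_true, if_false, Bool.false_eq_true] at h₁ h₂ h₃ h₄ <;> tauto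

end IsLinearFamily

theorem hasType_negType : HasType lt (negType p) x y ↔ HasType lt p y x :=
  forall_congr' fun _ => dir_not

theorem IsRealized.neg (hp : IsRealized lt p) : IsRealized lt (negType p) := by
  obtain ⟨x, y, hxy⟩ := hp
  exact ⟨y, x, hasType_negType.2 hxy⟩

theorem HasType.realized (hp : HasType lt p x y) : IsRealized lt p := ⟨x, y, hp⟩

namespace IsAut

variable {e : M ≃ M} (he : IsAut lt e)
include he

theorem dir : DirLT lt i b (e x) (e y) ↔ DirLT lt i b x y := by
  cases b <;> simp [DirLT, he i]

theorem hasType : HasType lt p (e x) (e y) ↔ HasType lt p x y :=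
  forall_congr' fun _ => he.dir

end IsAut

/-! ### Consequences of homogeneity -/

namespace IsPrimitiveHomogeneous

variable (h : IsPrimitiveHomogeneous lt)
include h

theorem exists_aut_one (x y : M) : ∃ e : M ≃ M, IsAut lt e ∧ e x = y := by
  obtain ⟨e, he, h'⟩ := h.homogeneous 1 (fun _ => x) (fun _ => y)
    (fun i _ _ => by simp [h.irrefl])
  exact ⟨e, he, h' 0⟩

theorem exists_aut_two {x' y' : M} (h₁ : HasType lt p x y) (h₂ : HasType lt p x' y') :
    ∃ e : M ≃ M, IsAut lt e ∧ e x = x' ∧ e y = y' := by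
  obtain ⟨e, he, h'⟩ := h.homogeneous 2 ![x, y] ![x', y'] (fun i j k => by
    have := h.lt_iff_of_dir (h₁ i) (h₂ i)
    fin_cases j <;> fin_cases k <;> simp [h.irrefl, this])
  exact ⟨e, he, h' 0, h' 1⟩

theorem exists_aut_three {r : ι → Bool} {x' y' z' : M}
    (h₁ : HasType lt p x y) (h₂ : HasType lt q y z) (h₃ : HasType lt r x z)
    (h₁' : HasType lt p x' y') (h₂' : HasType lt q y' z') (h₃' : HasType lt r x' z') :
    ∃ e : M ≃ M, IsAut lt e ∧ e x = x' ∧ e y = y' ∧ e z = z' := by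
  obtain ⟨e, he, h'⟩ := h.homogeneous 3 ![x, y, z] ![x', y', z'] (fun i j k => by
    have e₁ := h.lt_iff_of_dir (h₁ i) (h₁' i)
    have e₂ := h.lt_iff_of_dir (h₂ i) (h₂' i)
    have e₃ := h.lt_iff_of_dir (h₃ i) (h₃' i)
    fin_cases j <;> fin_cases k <;> simp [h.irrefl, e₁, e₂, e₃])
  exact ⟨e, he, h' 0, h' 1, h' 2⟩

/-- Two points `a`, `a'` that are related in the same way to each of `u`, `v`, `w` are conjugate
over `u`, `v`, `w`. -/
theorem exists_aut_fix {a a' u v w : M} (hu : HasType lt p a u) (hv : HasType lt p a v)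
    (hw : HasType lt p a w) (hu' : HasType lt p a' u) (hv' : HasType lt p a' v)
    (hw' : HasType lt p a' w) :
    ∃ e : M ≃ M, IsAut lt e ∧ e a = a' ∧ e u = u ∧ e v = v ∧ e w = w := by
  obtain ⟨e, he, h'⟩ := h.homogeneous 4 ![a, u, v, w] ![a', u, v, w] (fun i j k => by
    have e₁ := h.lt_iff_of_dir (hu i) (hu' i)
    have e₂ := h.lt_iff_of_dir (hv i) (hv' i)
    have e₃ := h.lt_iff_of_dir (hw i) (hw' i)
    fin_cases j <;> fin_cases k <;> simp [h.irrefl, e₁, e₂, e₃])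
  exact ⟨e, he, h' 0, h' 1, h' 2, h' 3⟩

theorem exists_hasType_right (hp : IsRealized lt p) (a : M) : ∃ z, HasType lt p a z := by
  obtain ⟨x, y, hxy⟩ := hp
  obtain ⟨e, he, rfl⟩ := h.exists_aut_one x a
  exact ⟨e y, he.hasType.2 hxy⟩

theorem exists_hasType_left (hp : IsRealized lt p) (a : M) : ∃ z, HasType lt p z a := by
  obtain ⟨z, hz⟩ := h.exists_hasType_right hp.neg a
  exact ⟨z, hasType_negType.1 hz⟩

theorem exists_dir (i : ι) (b : Bool) (x : M) : ∃ y, DirLT lt i b x y := by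
  obtain ⟨u, v, huv⟩ := h.nontrivial
  rcases h.dir_total i b u v with h' | h' | h'
  · obtain ⟨e, he, rfl⟩ := h.exists_aut_one u x
    exact ⟨e v, he.dir.2 h'⟩
  · exact absurd h' huv
  · obtain ⟨e, he, rfl⟩ := h.exists_aut_one v x
    exact ⟨e u, he.dir.2 h'⟩

theorem exists_dir_two (i : ι) (b : Bool) (x y : M) :
    ∃ z, DirLT lt i b x z ∧ DirLT lt i b y z := by
  rcases h.dir_total i b x y with h' | h' | h'
  · obtain ⟨z, hz⟩ := h.exists_dir i b y
    exact ⟨z, h.dir_trans h' hz, hz⟩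
  · obtain ⟨z, hz⟩ := h.exists_dir i b y
    exact ⟨z, h' ▸ hz, hz⟩
  · obtain ⟨z, hz⟩ := h.exists_dir i b x
    exact ⟨z, hz, h.dir_trans h' hz⟩

end IsPrimitiveHomogeneous

/-- The points that lie, in the `i`-th order directed by `b`, below some `z` such that `(a, z)` has
type `p`. -/
def shadow (lt : ι → M → M → Prop) (i : ι) (b : Bool) (p : ι → Bool) (a : M) : Set M :=
  {y | ∃ z, HasType lt p a z ∧ DirLT lt i b y z}

theorem IsLinearFamily.shadow_lower (h : IsLinearFamily lt) {a : M}
    (hy : y ∈ shadow lt i b p a) (hx : DirLT lt i b x y) : x ∈ shadow lt i b p a := by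
  obtain ⟨z, hz, hyz⟩ := hy
  exact ⟨z, hz, h.dir_trans hx hyz⟩

theorem IsAut.mem_shadow {e : M ≃ M} (he : IsAut lt e) {a : M} :
    e y ∈ shadow lt i b p (e a) ↔ y ∈ shadow lt i b p a := by
  constructor
  · rintro ⟨z, hz, hyz⟩
    rw [← e.apply_symm_apply z, he.hasType] at hz
    rw [← e.apply_symm_apply z, he.dir] at hyz
    exact ⟨_, hz, hyz⟩
  · rintro ⟨z, hz, hyz⟩
    exact ⟨e z, he.hasType.2 hz, he.dir.2 hyz⟩

theorem IsLinearFamily.shadow_total (h : IsLinearFamily lt) (i : ι) (b : Bool)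
    (p q : ι → Bool) (a : M) :
    shadow lt i b p a ⊆ shadow lt i b q a ∨ shadow lt i b q a ⊆ shadow lt i b p a := by
  by_contra! hcon
  obtain ⟨u, hu, hu'⟩ := Set.not_subset.1 hcon.1
  obtain ⟨v, hv, hv'⟩ := Set.not_subset.1 hcon.2
  rcases h.dir_total i b u v with h' | h' | h'
  · exact hu' (h.shadow_lower hv h')
  · exact hu' (h' ▸ hv)
  · exact hv' (h.shadow_lower hu h')

namespace IsPrimitiveHomogeneous

variable (h : IsPrimitiveHomogeneous lt)
include h

theorem shadow_subset_of {a a' : M} (hs : shadow lt i b p a ⊆ shadow lt i b q a) :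
    shadow lt i b p a' ⊆ shadow lt i b q a' := by
  obtain ⟨e, he, rfl⟩ := h.exists_aut_one a' a
  exact fun y hy => he.mem_shadow.1 (hs (he.mem_shadow.2 hy))

theorem shadow_univ_of {a a' : M} (hs : ∀ y, y ∈ shadow lt i b p a) (y : M) :
    y ∈ shadow lt i b p a' := by
  obtain ⟨e, he, rfl⟩ := h.exists_aut_one a' a
  exact he.mem_shadow.1 (hs _)

/-- Finitely many shadows that cover everything include one that is everything, because shadows
form a chain. -/
theorem exists_shadow_univ [Finite ι] (N : Set (ι → Bool)) (a : M)
    (hN : ∀ y, ∃ q ∈ N, y ∈ shadow lt i b q a) :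
    ∃ q ∈ N, ∀ a' y, y ∈ shadow lt i b q a' := by
  have hne : N.Nonempty := let ⟨q, hq, _⟩ := hN a; ⟨q, hq⟩
  obtain ⟨q, hq, hmax⟩ := N.toFinite.exists_maximalFor (fun q => shadow lt i b q a) N hne
  refine ⟨q, hq, fun a' => h.shadow_univ_of (a := a) fun y => ?_⟩
  obtain ⟨r, hr, hy⟩ := hN y
  rcases h.shadow_total i b q r a with h' | h'
  · exact hmax hr h' hy
  · exact h' hy

theorem mem_shadow {a : M} (hi : p i = b) (hx : HasType lt p a x) :
    x ∈ shadow lt i b p a := by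
  obtain ⟨z, hz⟩ := h.exists_hasType_right hx.realized x
  exact ⟨z, h.hasType_trans hx hz, hi ▸ hz i⟩

end IsPrimitiveHomogeneous

end Families

/-! ### Every realized type is cofinal -/

section Cofinal

variable {ι M : Type*} {lt : ι → M → M → Prop} {i : ι} {b : Bool} {p q : ι → Bool} {x y z : M}

/-- `y` lies above `x` and within the shadow of `x`. When `p` is the type with the smallest shadow,
this is a semilinear order. -/
def Near (lt : ι → M → M → Prop) (i : ι) (b : Bool) (p : ι → Bool) (x y : M) : Prop :=
  DirLT lt i b x y ∧ y ∈ shadow lt i b p x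

theorem IsAut.near {e : M ≃ M} (he : IsAut lt e) :
    Near lt i b p (e x) (e y) ↔ Near lt i b p x y :=
  and_congr he.dir he.mem_shadow

theorem IsLinearFamily.near_of_between (h : IsLinearFamily lt) (hn : Near lt i b p x z)
    (hxy : DirLT lt i b x y) (hyz : DirLT lt i b y z) : Near lt i b p x y :=
  ⟨hxy, h.shadow_lower hn.2 hyz⟩

namespace IsPrimitiveHomogeneous

variable (h : IsPrimitiveHomogeneous lt)
include h

/-- If `p` has the smallest shadow among the types that are positive at `i`, then the shadows are
nested: the point `y` near `x` has its shadow inside that of `x`. The type `q` of `(x, y)` satisfies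
`q(y) ⊆ q(x)`, and its shadow is the same as that of `p`. -/
theorem shadow_subset_of_near
    (hmin : ∀ q, IsRealized lt q → q i = b → ∀ a, shadow lt i b p a ⊆ shadow lt i b q a)
    (hn : Near lt i b p x y) : shadow lt i b p y ⊆ shadow lt i b p x := by
  have hne : x ≠ y := by
    rintro rfl
    exact h.dir_irrefl hn.1
  obtain ⟨q, hq⟩ := h.exists_hasType hne
  have hqi : q i = b := h.dir_unique (hq i) hn.1
  intro u hu
  obtain ⟨z, hz, huz⟩ := hmin q hq.realized hqi y hu
  have hxz := h.hasType_trans hq hz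
  obtain ⟨e, he, hex, hey⟩ := h.exists_aut_two hq hxz
  have hzs : z ∈ shadow lt i b p x := by
    have := he.mem_shadow.2 hn.2
    rwa [hex, hey] at this
  exact h.shadow_lower hzs huz

theorem near_trans
    (hmin : ∀ q, IsRealized lt q → q i = b → ∀ a, shadow lt i b p a ⊆ shadow lt i b q a)
    (h₁ : Near lt i b p x y) (h₂ : Near lt i b p y z) : Near lt i b p x z :=
  ⟨h.dir_trans h₁.1 h₂.1, h.shadow_subset_of_near hmin h₁ h₂.2⟩

/-- Having a common lower bound for the semilinear order `Near` is an invariant equivalence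
relation, so by primitivity any two points have a common lower bound. -/
theorem exists_common_near (hp : IsRealized lt p) (hpi : p i = b)
    (hmin : ∀ q, IsRealized lt q → q i = b → ∀ a, shadow lt i b p a ⊆ shadow lt i b q a)
    (x y : M) :
    ∃ w, (w = x ∨ Near lt i b p w x) ∧ (w = y ∨ Near lt i b p w y) := by
  have htr : ∀ u v w : M, (u = v ∨ Near lt i b p u v) → (v = w ∨ Near lt i b p v w) →
      (u = w ∨ Near lt i b p u w) := by
    rintro u v w (rfl | h₁) (rfl | h₂)
    · exact Or.inl rfl
    · exact Or.inr h₂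
    · exact Or.inr h₁
    · exact Or.inr (h.near_trans hmin h₁ h₂)
  have hch : ∀ u v w : M, (u = w ∨ Near lt i b p u w) → (v = w ∨ Near lt i b p v w) →
      (u = v ∨ Near lt i b p u v) ∨ (v = u ∨ Near lt i b p v u) := by
    rintro u v w (rfl | h₁) (rfl | h₂)
    · exact Or.inl (Or.inl rfl)
    · exact Or.inr (Or.inr h₂)
    · exact Or.inl (Or.inr h₁)
    · rcases h.dir_total i b u v with h' | h' | h'
      · exact Or.inl (Or.inr (h.near_of_between h₁ h' h₂.1))
      · exact Or.inl (Or.inl h')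
      · exact Or.inr (Or.inr (h.near_of_between h₂ h' h₁.1))
  let r : Setoid M :=
    { r := fun x y => ∃ w, (w = x ∨ Near lt i b p w x) ∧ (w = y ∨ Near lt i b p w y)
      iseqv :=
        { refl := fun x => ⟨x, Or.inl rfl, Or.inl rfl⟩
          symm := fun ⟨w, h₁, h₂⟩ => ⟨w, h₂, h₁⟩
          trans := by
            rintro x y z ⟨u, hux, huy⟩ ⟨v, hvy, hvz⟩
            rcases hch u v y huy hvy with h' | h'
            · exact ⟨u, hux, htr u v z h' hvz⟩
            · exact ⟨v, htr v u x h' hux, hvz⟩ } }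
  have hinv : ∀ e : M ≃ M, IsAut lt e → ∀ x y, r x y → r (e x) (e y) := by
    rintro e he x y ⟨w, h₁, h₂⟩
    exact ⟨e w, h₁.imp (congrArg e) he.near.2, h₂.imp (congrArg e) he.near.2⟩
  rcases h.primitive r hinv with hr | hr
  · obtain ⟨z, hz⟩ := h.exists_hasType_right hp x
    have hd : DirLT lt i b x z := hpi ▸ hz i
    have : r x z := ⟨x, Or.inl rfl, Or.inr ⟨hd, h.mem_shadow hpi hz⟩⟩
    rw [hr] at this
    have hxz : x = z := this
    exact absurd (hxz ▸ hd) h.dir_irrefl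
  · have : r x y := by rw [hr]; trivial
    exact this

/-- A realized type `p` is cofinal in the `i`-th order: for every `a`, the points `z` such that
`(a, z)` has type `p` are not bounded in the direction `p i`. -/
theorem mem_shadow_of_isRealized [Finite ι] (hp : IsRealized lt p) (hpi : p i = b) (a y : M) :
    y ∈ shadow lt i b p a := by
  by_contra hcon
  obtain ⟨p₀, ⟨hp₀, hpi₀⟩, hmin₀⟩ :=
    ({q | IsRealized lt q ∧ q i = b} : Set (ι → Bool)).toFinite.exists_minimalFor
      (fun q => shadow lt i b q a) _ ⟨p, hp, hpi⟩
  have hmin : ∀ q, IsRealized lt q → q i = b → ∀ a,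
      shadow lt i b p₀ a ⊆ shadow lt i b q a := by
    intro q hq hqi a'
    refine h.shadow_subset_of (a := a) ?_
    rcases h.shadow_total i b p₀ q a with h' | h'
    · exact h'
    · exact hmin₀ ⟨hq, hqi⟩ h'
  have hbd : ∀ a', ∃ y, y ∉ shadow lt i b p₀ a' := by
    intro a'
    by_contra! hall
    exact hcon (hmin p hp hpi a (h.shadow_univ_of hall y))
  -- A type `s` of near pairs that is coinitial below each point.
  obtain ⟨t, ⟨s, ⟨hs, hsi, hsn⟩, rfl⟩, hsc⟩ : ∃ t ∈ negType '' {s : ι → Bool | IsRealized lt s ∧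
      s i = b ∧ ∀ x y, HasType lt s x y → Near lt i b p₀ x y},
      ∀ a' y, y ∈ shadow lt i (!b) t a' := by
    refine h.exists_shadow_univ _ a fun y => ?_
    obtain ⟨y', hya, hyy⟩ := h.exists_dir_two i (!b) a y
    rw [dir_not] at hya hyy
    obtain ⟨w, hwa, hwy⟩ := h.exists_common_near hp₀ hpi₀ hmin a y'
    have hwy' : DirLT lt i b w y ∧ DirLT lt i b w a := by
      rcases hwy with rfl | hwy
      · exact ⟨hyy, hya⟩
      · exact ⟨h.dir_trans hwy.1 hyy, h.dir_trans hwy.1 hya⟩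
    have hn : Near lt i b p₀ w a := by
      rcases hwa with rfl | hwa
      · exact absurd hwy'.2 h.dir_irrefl
      · exact hwa
    obtain ⟨s, hs⟩ := h.exists_hasType (x := w) (y := a) fun hwa =>
      h.dir_irrefl (hwa ▸ hn.1)
    refine ⟨negType s, ⟨s, ⟨hs.realized, h.dir_unique (hs i) hn.1, fun x y hxy => ?_⟩, rfl⟩,
      w, hasType_negType.2 hs, dir_not.2 hwy'.1⟩
    obtain ⟨e, he, rfl, rfl⟩ := h.exists_aut_two hs hxy
    exact he.near.2 hn
  have hcoin : ∀ c y : M, ∃ x, HasType lt s x c ∧ DirLT lt i b x y := fun c y => by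
    obtain ⟨x, hx, hxy⟩ := hsc c y
    exact ⟨x, hasType_negType.1 hx, dir_not.1 hxy⟩
  -- A cofinal type `d` that agrees with `s` at a maximal set of indices.
  obtain ⟨d, ⟨hd, hdi, hdc⟩, hdmax⟩ :=
    ({d | IsRealized lt d ∧ d i = b ∧ ∀ a y, y ∈ shadow lt i b d a} :
      Set (ι → Bool)).toFinite.exists_maximalFor (fun d => {j | d j = s j}) _ (by
      obtain ⟨d, ⟨hd, hdi⟩, hdc⟩ := h.exists_shadow_univ (i := i) (b := b)
        {d | IsRealized lt d ∧ d i = b} a fun y => by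
          obtain ⟨z, haz, hyz⟩ := h.exists_dir_two i b a y
          obtain ⟨d, hd⟩ := h.exists_hasType (x := a) (y := z) fun haz' =>
            h.dir_irrefl (haz' ▸ haz)
          exact ⟨d, ⟨hd.realized, h.dir_unique (hd i) haz⟩, z, hd, hyz⟩
      exact ⟨d, hd, hdi, hdc⟩)
  have hds : ∀ u v w, HasType lt d u v → HasType lt s v w → HasType lt d u w := by
    intro u v w huv hvw
    have hvw' : DirLT lt i b v w := hsi ▸ hvw i
    have huw : DirLT lt i b u w := h.dir_trans (hdi ▸ huv i) hvw'
    obtain ⟨t, ht⟩ := h.exists_hasType (x := u) (y := w) fun e => h.dir_irrefl (e ▸ huw)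
    have hti : t i = b := h.dir_unique (ht i) huw
    -- The type of `(u, w)` is cofinal, since its shadow contains all of `d(u)`.
    have htc : ∀ y, y ∈ shadow lt i b t u := by
      intro y
      obtain ⟨z, hz, hyz⟩ := hdc u y
      obtain ⟨e, he, heu, hev⟩ := h.exists_aut_two huv hz
      have hv : v ∈ shadow lt i b t u := h.shadow_lower (h.mem_shadow hti ht) hvw'
      have := he.mem_shadow.2 hv
      rw [heu, hev] at this
      exact h.shadow_lower this hyz
    have hsub : {j | d j = s j} ⊆ {j | t j = s j} := by
      intro j (hj : d j = s j)
      exact h.dir_unique (ht j) (h.dir_trans (hj ▸ huv j) (hvw j))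
    have hsub' := hdmax ⟨ht.realized, hti, fun a' y => h.shadow_univ_of htc y⟩ hsub
    have : t = d := by
      funext j
      by_cases hj : d j = s j
      · rw [hj]; exact hsub hj
      · have hj' : ¬ t j = s j := fun h' => hj (hsub' h')
        revert hj hj'
        cases t j <;> cases d j <;> cases s j <;> simp
    exact this ▸ ht
  -- A chain `u, v, c` of type `d` such that `v` and `c` are near some `x` above `u`.
  obtain ⟨c₀, v, hvc⟩ := hd.neg
  rw [hasType_negType] at hvc
  obtain ⟨w, hwv, hwc⟩ := h.exists_common_near hp₀ hpi₀ hmin v c₀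
  have hvc' : DirLT lt i b v c₀ := hdi ▸ hvc i
  obtain ⟨x, hxv, hxw⟩ := hcoin v w
  have hxv' : Near lt i b p₀ x v := hsn x v hxv
  have hnw : Near lt i b p₀ x w := by
    rcases hwv with rfl | hwv
    · exact hxv'
    · exact h.near_of_between hxv' hxw hwv.1
  have hxc : Near lt i b p₀ x c₀ := by
    rcases hwc with rfl | hwc
    · exact hnw
    · exact h.near_trans hmin hnw hwc
  obtain ⟨u, hux⟩ := h.exists_hasType_left hd x
  have huv := hds u x v hux hxv
  have huc := h.hasType_trans huv hvc
  -- All of `d(v)` lies in the shadow of a common lower bound of `u` and `v`.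
  obtain ⟨w', hw'u, hw'v⟩ := h.exists_common_near hp₀ hpi₀ hmin u v
  obtain ⟨y', hy'⟩ := hbd w'
  obtain ⟨c', hc', hyc'⟩ := hdc v y'
  obtain ⟨e, he, heu, hev, hec⟩ :=
    h.exists_aut_three huv hvc huc huv hc' (h.hasType_trans huv hc')
  have hex₁ : DirLT lt i b u (e x) := by
    have : DirLT lt i b (e u) (e x) := he.dir.2 (hdi ▸ hux i)
    rwa [heu] at this
  have hex₂ : Near lt i b p₀ (e x) v := by
    have := he.near.2 hxv'
    rwa [hev] at this
  have hex₃ : Near lt i b p₀ (e x) c' := by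
    have := he.near.2 hxc
    rwa [hec] at this
  have hw'x : DirLT lt i b w' (e x) := by
    rcases hw'u with rfl | h'
    · exact hex₁
    · exact h.dir_trans h'.1 hex₁
  have hw'v' : Near lt i b p₀ w' v := by
    rcases hw'v with rfl | h'
    · exact absurd hex₂.1 (h.dir_asymm hw'x)
    · exact h'
  have hnear := h.near_trans hmin (h.near_of_between hw'v' hw'x hex₂.1) hex₃
  exact hy' (h.shadow_lower hnear.2 hyc')

theorem exists_hasType_dir [Finite ι] (hp : IsRealized lt p) (i : ι) (a y : M) :
    ∃ z, HasType lt p a z ∧ DirLT lt i (p i) y z :=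
  h.mem_shadow_of_isRealized hp rfl a y

end IsPrimitiveHomogeneous

end Cofinal

/-! ### Density and independence of the orders -/

section Independence

variable {ι M : Type*} {lt : ι → M → M → Prop} {i : ι} {b : Bool} {p q t : ι → Bool}
  {x y z : M}

/-- The orders with index in `J` are jointly dense: every box with sides in these orders contains a
point. -/
def JointlyDense (lt : ι → M → M → Prop) (J : Set ι) : Prop :=
  ∀ lo hi : ι → M, (∀ j ∈ J, lt j (lo j) (hi j)) →
    ∃ z, ∀ j ∈ J, lt j (lo j) z ∧ lt j z (hi j)

namespace IsPrimitiveHomogeneous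

variable (h : IsPrimitiveHomogeneous lt)
include h

/-- The points `z` such that `(a, z)` has type `p` accumulate at `a`: otherwise some type would be
confined to the gap between `a` and these points, and not be cofinal. -/
theorem exists_hasType_lt [Finite ι] (hp : IsRealized lt p) (a y : M)
    (hay : DirLT lt i (p i) a y) : ∃ z, HasType lt p a z ∧ DirLT lt i (p i) z y := by
  by_contra! hcon
  obtain ⟨q, hq⟩ := h.exists_hasType (x := a) (y := y) fun e => h.dir_irrefl (e ▸ hay)
  have hqi : q i = p i := h.dir_unique (hq i) hay
  obtain ⟨z, hz⟩ := h.exists_hasType_right hp a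
  obtain ⟨y', hy', hzy'⟩ := h.exists_hasType_dir hq.realized i a z
  obtain ⟨e, he, hea, hey⟩ := h.exists_aut_two hy' hq
  refine hcon (e z) ?_ ?_
  · rw [← hea]; exact he.hasType.2 hz
  · rw [← hey, he.dir, ← hqi]; exact hzy'

/-- The points `z` such that `(a, z)` has type `p` are dense on their side of `a`. A gap above `x`
would, by homogeneity, contain all `z'` for which `(x, z')` has the same type as `(a, x)`. -/
theorem exists_hasType_between [Finite ι] (hp : IsRealized lt p) (a x y : M)
    (hax : x = a ∨ DirLT lt i (p i) a x) (hxy : DirLT lt i (p i) x y) :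
    ∃ z, HasType lt p a z ∧ DirLT lt i (p i) x z ∧ DirLT lt i (p i) z y := by
  rcases hax with rfl | hax
  · obtain ⟨z, hz, hzy⟩ := h.exists_hasType_lt hp x y hxy
    exact ⟨z, hz, hz i, hzy⟩
  by_contra! hcon
  obtain ⟨q, hq⟩ := h.exists_hasType (x := a) (y := x) fun e => h.dir_irrefl (e ▸ hax)
  have hqi : q i = p i := h.dir_unique (hq i) hax
  obtain ⟨z, hz, hzy⟩ := h.exists_hasType_lt hq.realized x y (hqi ▸ hxy)
  obtain ⟨u, hu, hxu⟩ := h.exists_hasType_dir hp i a x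
  obtain ⟨z', hz', huz'⟩ := h.exists_hasType_dir hq.realized i x u
  obtain ⟨e, he, hea, hex, hez⟩ := h.exists_aut_three hq hz' (h.hasType_trans hq hz')
    hq hz (h.hasType_trans hq hz)
  refine hcon (e u) ?_ ?_ ?_
  · rw [← hea]; exact he.hasType.2 hu
  · rw [← hex]; exact he.dir.2 hxu
  · refine h.dir_trans (y := z) ?_ (hqi ▸ hzy)
    rw [← hez, ← hqi]; exact he.dir.2 huz'

/-- For a realized type `p`, the partial order "`(x, y)` has type `p`" is directed downwards. -/
theorem exists_hasType_left_two [Finite ι] (hp : IsRealized lt p) (a x : M) :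
    ∃ a', HasType lt p a' a ∧ HasType lt p a' x := by
  classical
  have := Fintype.ofFinite ι
  suffices ∀ J : Finset ι, ∃ a', HasType lt p a' a ∧ ∀ j ∈ J, DirLT lt j (p j) a' x by
    obtain ⟨a', h₁, h₂⟩ := this Finset.univ
    exact ⟨a', h₁, fun j => h₂ j (Finset.mem_univ j)⟩
  intro J
  induction J using Finset.induction_on with
  | empty =>
    obtain ⟨a', ha'⟩ := h.exists_hasType_left hp a
    exact ⟨a', ha', by simp⟩
  | insert k J _ ih =>
    obtain ⟨a', ha', hJ⟩ := ih
    obtain ⟨z, hz, hzx⟩ := h.exists_hasType_dir hp.neg k a' x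
    have hz' := hasType_negType.1 hz
    refine ⟨z, h.hasType_trans hz' ha', fun j hj => ?_⟩
    rcases Finset.mem_insert.1 hj with rfl | hj
    · exact dir_not.1 hzx
    · exact h.dir_trans (hz' j) (hJ j hj)

theorem exists_hasType_left_four [Finite ι] (hp : IsRealized lt p) (u v w x : M) :
    ∃ a, HasType lt p a u ∧ HasType lt p a v ∧ HasType lt p a w ∧ HasType lt p a x := by
  obtain ⟨a, hau, hav⟩ := h.exists_hasType_left_two hp u v
  obtain ⟨a', haw, hax⟩ := h.exists_hasType_left_two hp w x
  obtain ⟨c, hca, hca'⟩ := h.exists_hasType_left_two hp a a'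
  exact ⟨c, h.hasType_trans hca hau, h.hasType_trans hca hav, h.hasType_trans hca' haw,
    h.hasType_trans hca' hax⟩

/-- Let `(a, v)`, `(a, x₁)`, `(a, x₂)` have type `t`. If there is any point `z` with a prescribed
type over `v` and with a prescribed position between `x₁` and `x₂`, there is one such that `(a, z)`
has type `t`: some `a'` is related by `t` to `v`, `x₁`, `x₂` and `z`, and it is conjugate to `a`. -/
theorem exists_hasType_of_dense [Finite ι] {a v x₁ x₂ : M} {r : ι → Bool} {c : Bool}
    (hv : HasType lt t a v) (h₁ : HasType lt t a x₁) (h₂ : HasType lt t a x₂)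
    (hz : ∃ z, HasType lt r v z ∧ DirLT lt i c x₁ z ∧ DirLT lt i c z x₂) :
    ∃ z, HasType lt t a z ∧ HasType lt r v z ∧ DirLT lt i c x₁ z ∧ DirLT lt i c z x₂ := by
  obtain ⟨z, hvz, hz₁, hz₂⟩ := hz
  obtain ⟨a', hv', h₁', h₂', hz'⟩ := h.exists_hasType_left_four hv.realized v x₁ x₂ z
  obtain ⟨e, he, hea, hev, he₁, he₂⟩ := h.exists_aut_fix hv' h₁' h₂' hv h₁ h₂
  refine ⟨e z, ?_, ?_, ?_, ?_⟩
  · rw [← hea]; exact he.hasType.2 hz'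
  · rw [← hev]; exact he.hasType.2 hvz
  · rw [← he₁]; exact he.dir.2 hz₁
  · rw [← he₂]; exact he.dir.2 hz₂

/-- Let `(a, v)` have type `t`, and let `t'` be a realized type that agrees with `t` on `J` but not
at `k`. The points that lie between `a` and `v` in the orders from `J` are dense in the `k`-th order
on the side of `a` on which `v` lies. -/
theorem exists_between_of_dir [Finite ι] {J : Set ι} {k : ι} {a v : M} {t' : ι → Bool}
    (hv : HasType lt t a v) (ht' : IsRealized lt t') (hk : t' k = !t k)
    (hJ : ∀ j ∈ J, t' j = t j) {y y' : M} (hay : y = a ∨ DirLT lt k (t k) a y)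
    (hyy' : DirLT lt k (t k) y y') :
    ∃ z, DirLT lt k (t k) y z ∧ DirLT lt k (t k) z y' ∧
      ∀ j ∈ J, DirLT lt j (t j) a z ∧ DirLT lt j (t j) z v := by
  -- It suffices to deal with an interval that lies on one side of `v`.
  suffices key : ∀ u u', (u = a ∨ DirLT lt k (t k) a u) → DirLT lt k (t k) u u' →
      (v = u ∨ DirLT lt k (t k) v u ∨ u' = v ∨ DirLT lt k (t k) u' v) →
      ∃ z, DirLT lt k (t k) u z ∧ DirLT lt k (t k) z u' ∧
        ∀ j ∈ J, DirLT lt j (t j) a z ∧ DirLT lt j (t j) z v by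
    rcases h.dir_total k (t k) y v with h₁ | h₁ | h₁
    · rcases h.dir_total k (t k) y' v with h₂ | h₂ | h₂
      · exact key y y' hay hyy' (Or.inr (Or.inr (Or.inr h₂)))
      · exact key y y' hay hyy' (Or.inr (Or.inr (Or.inl h₂)))
      · obtain ⟨z, hz₁, hz₂, hz⟩ := key y v hay h₁ (Or.inr (Or.inr (Or.inl rfl)))
        exact ⟨z, hz₁, h.dir_trans hz₂ h₂, hz⟩
    · exact key y y' hay hyy' (Or.inl h₁.symm)
    · exact key y y' hay hyy' (Or.inr (Or.inl h₁))
  intro u u' hau huu' hside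
  obtain ⟨x₂, hx₂, hux₂, hx₂u'⟩ := h.exists_hasType_between hv.realized a u u' hau huu'
  obtain ⟨x₁, hx₁, hux₁, hx₁₂⟩ := h.exists_hasType_between hv.realized a u x₂ hau hux₂
  have fin : ∀ r : ι → Bool, (∀ j ∈ J, r j = !t j) →
      (∃ z, HasType lt r v z ∧ DirLT lt k (t k) x₁ z ∧ DirLT lt k (t k) z x₂) →
      ∃ z, DirLT lt k (t k) u z ∧ DirLT lt k (t k) z u' ∧
        ∀ j ∈ J, DirLT lt j (t j) a z ∧ DirLT lt j (t j) z v := by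
    intro r hr hz
    obtain ⟨z, hz, hvz, hz₁, hz₂⟩ := h.exists_hasType_of_dense hv hx₁ hx₂ hz
    refine ⟨z, h.dir_trans hux₁ hz₁, h.dir_trans hz₂ hx₂u', fun j hj => ⟨hz j, ?_⟩⟩
    have := hvz j
    rwa [hr j hj, dir_not] at this
  by_cases hvu : v = u ∨ DirLT lt k (t k) v u
  · -- The interval is above `v`, and the reversal of `t'` points there.
    have hvx₁ : DirLT lt k (t k) v x₁ := by
      rcases hvu with rfl | hvu
      · exact hux₁
      · exact h.dir_trans hvu hux₁
    have hs : negType t' k = t k := by simp [negType, hk]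
    obtain ⟨z, hz, hz₁, hz₂⟩ := h.exists_hasType_between (i := k) ht'.neg v x₁ x₂
      (Or.inr (hs ▸ hvx₁)) (hs ▸ hx₁₂)
    exact fin _ (fun j hj => by simp [negType, hJ j hj]) ⟨z, hz, hs ▸ hz₁, hs ▸ hz₂⟩
  · -- The interval is below `v`, and the reversal of `t` points there.
    have hx₂v : DirLT lt k (t k) x₂ v := by
      rcases hside with h' | h' | rfl | h'
      · exact absurd (Or.inl h') hvu
      · exact absurd (Or.inr h') hvu
      · exact hx₂u'
      · exact h.dir_trans hx₂u' h'
    obtain ⟨z, hz, hz₁, hz₂⟩ := h.exists_hasType_between (i := k) hv.realized.neg v x₂ x₁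
      (Or.inr (dir_not.2 hx₂v)) (dir_not.2 hx₁₂)
    exact fin _ (fun j _ => rfl) ⟨z, hz, dir_not.1 hz₂, dir_not.1 hz₁⟩

/-- If the orders from `J` are jointly dense and some two realized types differ at `k` but agree
on `J`, then the `k`-th order can be added to `J`. -/
theorem jointlyDense_insert [Finite ι] {J : Set ι} {k : ι} {p p' : ι → Bool}
    (hJ : JointlyDense lt J) (hp : IsRealized lt p) (hp' : IsRealized lt p')
    (hpp' : ∀ j ∈ J, p j = p' j) (hk : p k ≠ p' k) : JointlyDense lt (insert k J) := by
  intro lo hi hlohi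
  -- Points `a` and `v` of the box over `J` such that `(a, v)` agrees with `p` on `J`.
  obtain ⟨a, ha⟩ := hJ lo hi fun j hj => hlohi j (Set.mem_insert_of_mem k hj)
  obtain ⟨v, hv⟩ := hJ (fun j => if p j then a else lo j) (fun j => if p j then hi j else a)
    (fun j hj => by cases p j <;> simp [ha j hj])
  have hav : ∀ j ∈ J, DirLT lt j (p j) a v := by
    intro j hj
    obtain ⟨h₁, h₂⟩ := hv j hj
    cases hpj : p j <;> simp only [hpj, if_true, if_false, Bool.false_eq_true] at h₁ h₂
    · exact h₂
    · exact h₁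
  have hvbox : ∀ j ∈ J, lt j (lo j) v ∧ lt j v (hi j) := by
    intro j hj
    obtain ⟨h₁, h₂⟩ := hv j hj
    obtain ⟨h₃, h₄⟩ := ha j hj
    cases hpj : p j <;> simp only [hpj, if_true, if_false, Bool.false_eq_true] at h₁ h₂
    · exact ⟨h₁, h.trans _ _ _ _ h₂ h₄⟩
    · exact ⟨h.trans _ _ _ _ h₃ h₁, h₂⟩
  -- It suffices to find a point between `a` and `v` in the orders from `J`.
  have hbox : ∀ (t : ι → Bool) z, lt k (lo k) z → lt k z (hi k) →
      (∀ j ∈ J, DirLT lt j (t j) a z ∧ DirLT lt j (t j) z v) →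
      ∃ z, ∀ j ∈ insert k J, lt j (lo j) z ∧ lt j z (hi j) := by
    intro t z h₁ h₂ hz
    refine ⟨z, fun j hj => ?_⟩
    rcases Set.mem_insert_iff.1 hj with rfl | hj
    · exact ⟨h₁, h₂⟩
    · obtain ⟨h₃, h₄⟩ := hz j hj
      obtain ⟨h₅, h₆⟩ := ha j hj
      obtain ⟨h₇, h₈⟩ := hvbox j hj
      cases htj : t j <;> simp only [DirLT, htj, if_true, if_false, Bool.false_eq_true] at h₃ h₄
      · exact ⟨h.trans _ _ _ _ h₇ h₄, h.trans _ _ _ _ h₃ h₆⟩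
      · exact ⟨h.trans _ _ _ _ h₅ h₃, h.trans _ _ _ _ h₄ h₈⟩
  by_cases hne : a = v
  · -- Equality is possible only if `J` is empty, and then the density of one order is enough.
    have hJe : ∀ j, j ∉ J := fun j hj => h.dir_irrefl (hne ▸ hav j hj)
    have hlh := hlohi k (Set.mem_insert k J)
    obtain ⟨q, hq, hqk⟩ : ∃ q, IsRealized lt q ∧ q k = true := by
      cases hpk : p k
      · exact ⟨negType p, hp.neg, by simp [negType, hpk]⟩
      · exact ⟨p, hp, hpk⟩
    obtain ⟨z, -, hz₁, hz₂⟩ := h.exists_hasType_between (i := k) hq (lo k) (lo k) (hi k)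
      (Or.inl rfl) (by simpa [DirLT, hqk] using hlh)
    simp only [DirLT, hqk, if_true] at hz₁ hz₂
    exact hbox p z hz₁ hz₂ fun j hj => absurd hj (hJe j)
  obtain ⟨t, ht⟩ := h.exists_hasType hne
  have htJ : ∀ j ∈ J, t j = p j := fun j hj => h.dir_unique (ht j) (hav j hj)
  obtain ⟨t', ht', ht'k, ht'J⟩ : ∃ t', IsRealized lt t' ∧ t' k = (!t k) ∧ ∀ j ∈ J, t' j = t j := by
    by_cases hpk : p k = t k
    · refine ⟨p', hp', ?_, fun j hj => (hpp' j hj).symm.trans (htJ j hj).symm⟩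
      rw [← hpk]
      revert hk
      cases p k <;> cases p' k <;> simp
    · refine ⟨p, hp, ?_, fun j hj => (htJ j hj).symm⟩
      revert hpk
      cases p k <;> cases t k <;> simp
  -- The `k`-th side of the box, with its ends in the order given by `t k`.
  obtain ⟨y, y', hyy', hlh⟩ : ∃ y y', DirLT lt k (t k) y y' ∧
      ∀ z, DirLT lt k (t k) y z → DirLT lt k (t k) z y' → lt k (lo k) z ∧ lt k z (hi k) := by
    have hlh := hlohi k (Set.mem_insert k J)
    cases htk : t k
    · exact ⟨hi k, lo k, by simpa [DirLT] using hlh, fun z h₁ h₂ => by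
        simp only [DirLT, if_false, Bool.false_eq_true] at h₁ h₂; exact ⟨h₂, h₁⟩⟩
    · exact ⟨lo k, hi k, by simpa [DirLT] using hlh, fun z h₁ h₂ => by
        simp only [DirLT, if_true] at h₁ h₂; exact ⟨h₁, h₂⟩⟩
  rcases h.dir_total k (t k) a y' with hay' | hay'
  · obtain ⟨x, hax, hyx, hxy'⟩ : ∃ x, (x = a ∨ DirLT lt k (t k) a x) ∧
        (x = y ∨ DirLT lt k (t k) y x) ∧ DirLT lt k (t k) x y' := by
      rcases h.dir_total k (t k) a y with h' | h' | h'
      · exact ⟨y, Or.inr h', Or.inl rfl, hyy'⟩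
      · exact ⟨y, Or.inl h'.symm, Or.inl rfl, hyy'⟩
      · exact ⟨a, Or.inl rfl, Or.inr h', hay'⟩
    obtain ⟨z, hz₁, hz₂, hz⟩ := h.exists_between_of_dir ht ht' ht'k ht'J hax hxy'
    obtain ⟨h₁, h₂⟩ := hlh z (hyx.elim (fun e => e ▸ hz₁) fun h' => h.dir_trans h' hz₁) hz₂
    exact hbox t z h₁ h₂ hz
  · -- The interval is below `a`, hence below `v`: exchange the roles of `a` and `v`.
    have hy'v : DirLT lt k (t k) y' v := by
      rcases hay' with rfl | h'
      · exact ht k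
      · exact h.dir_trans h' (ht k)
    obtain ⟨z, hz₁, hz₂, hz⟩ := h.exists_between_of_dir (J := J) (k := k) (t := negType t)
      (t' := negType t') (a := v) (v := a) (y := y') (y' := y) (hasType_negType.2 ht) ht'.neg
      (by simp [negType, ht'k]) (fun j hj => by simp [negType, ht'J j hj])
      (Or.inr (dir_not.2 hy'v)) (dir_not.2 hyy')
    obtain ⟨h₁, h₂⟩ := hlh z (dir_not.1 hz₂) (dir_not.1 hz₁)
    exact hbox t z h₁ h₂ fun j hj => ⟨dir_not.1 (hz j hj).2, dir_not.1 (hz j hj).1⟩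

end IsPrimitiveHomogeneous

/-- Among three orders, choose a maximal jointly dense set `J`. An order outside `J` has its sign
determined on realized types by the signs in `J`; since `J` has at most two elements, it agrees with
one of the orders from `J` up to reversal. -/
theorem IsPrimitiveHomogeneous.exists_sign_eq {lt : Fin 3 → M → M → Prop}
    (h : IsPrimitiveHomogeneous lt) :
    ∃ J : Set (Fin 3), JointlyDense lt J ∧ J.Nonempty ∧ ∀ k ∉ J, ∃ j ∈ J, ∃ c : Bool,
      ∀ p, IsRealized lt p → p k = (p j ^^ c) := by
  obtain ⟨x₀, y₀, hxy₀⟩ := h.nontrivial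
  obtain ⟨p₀, hp₀⟩ := h.exists_hasType hxy₀
  obtain ⟨J, hJ, hmax⟩ := ({J | JointlyDense lt J} : Set (Set (Fin 3))).toFinite.exists_maximalFor
    id _ ⟨∅, fun _ _ _ => ⟨x₀, by simp⟩⟩
  have hdet : ∀ k ∉ J, ∀ p p', IsRealized lt p → IsRealized lt p' → (∀ j ∈ J, p j = p' j) →
      p k = p' k := by
    intro k hk p p' hp hp' hpp'
    by_contra hne
    exact hk (hmax (h.jointlyDense_insert hJ hp hp' hpp' hne) (Set.subset_insert k J)
      (Set.mem_insert k J))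
  have hJne : J.Nonempty := by
    by_contra hJe
    rw [Set.not_nonempty_iff_eq_empty] at hJe
    have := hdet 0 (by simp [hJe]) p₀ _ hp₀.realized hp₀.realized.neg (by simp [hJe])
    simp [negType] at this
  refine ⟨J, hJ, hJne, fun k hk => ?_⟩
  obtain ⟨j₁, hj₁, j₂, hj₂, hj⟩ : ∃ j₁ ∈ J, ∃ j₂ ∈ J, ∀ j ∈ J, j = j₁ ∨ j = j₂ := by
    obtain ⟨j₁, hj₁⟩ := hJne
    by_cases hex : ∃ j₂ ∈ J, j₂ ≠ j₁
    · obtain ⟨j₂, hj₂, hne⟩ := hex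
      refine ⟨j₁, hj₁, j₂, hj₂, fun j hj => ?_⟩
      have h₁ : j ≠ k := fun e => hk (e ▸ hj)
      have h₂ : j₁ ≠ k := fun e => hk (e ▸ hj₁)
      have h₃ : j₂ ≠ k := fun e => hk (e ▸ hj₂)
      omega
    · push Not at hex
      exact ⟨j₁, hj₁, j₁, hj₁, fun j hj => Or.inl (hex j hj)⟩
  -- Two realized types cannot differ, relative to `k`, both at `j₁` and at `j₂`: after negation of
  -- one of them if necessary, they would agree on `J` but not at `k`.
  have hx : ∀ p p', IsRealized lt p → IsRealized lt p' →
      (p k = p j₁ ↔ p' k = p' j₁) ∨ (p k = p j₂ ↔ p' k = p' j₂) := by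
    intro p p' hp hp'
    have d₁ := hdet k hk p p' hp hp'
    have d₂ := hdet k hk p (negType p') hp hp'.neg
    have d₁' : p j₁ = p' j₁ → p j₂ = p' j₂ → p k = p' k := fun e₁ e₂ => d₁ fun j hjJ => by
      rcases hj j hjJ with rfl | rfl <;> assumption
    have d₂' : p j₁ = (!p' j₁) → p j₂ = (!p' j₂) → p k = !p' k := fun e₁ e₂ => d₂ fun j hjJ => by
      rcases hj j hjJ with rfl | rfl <;> assumption
    revert d₁' d₂'
    generalize p j₁ = a, p j₂ = b, p k = c, p' j₁ = a', p' j₂ = b', p' k = c'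
    revert a b c a' b' c'
    decide
  by_contra! hcon
  obtain ⟨p₁, hp₁, e₁⟩ := hcon j₁ hj₁ false
  obtain ⟨p₂, hp₂, e₂⟩ := hcon j₁ hj₁ true
  obtain ⟨p₃, hp₃, e₃⟩ := hcon j₂ hj₂ false
  obtain ⟨p₄, hp₄, e₄⟩ := hcon j₂ hj₂ true
  have n₁ : ¬ p₁ k = p₁ j₁ := by simpa using e₁
  have n₂ : p₂ k = p₂ j₁ := by simpa using e₂
  have n₃ : ¬ p₃ k = p₃ j₂ := by simpa using e₃
  have n₄ : p₄ k = p₄ j₂ := by simpa using e₄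
  have h₁₂ := hx p₁ p₂ hp₁ hp₂
  have h₁₃ := hx p₁ p₃ hp₁ hp₃
  have h₁₄ := hx p₁ p₄ hp₁ hp₄
  have h₂₃ := hx p₂ p₃ hp₂ hp₃
  have h₂₄ := hx p₂ p₄ hp₂ hp₄
  have h₃₄ := hx p₃ p₄ hp₃ hp₄
  simp only [n₁, n₂, n₃, n₄, iff_true, iff_false, false_iff, true_iff, false_or,
    or_false] at h₁₂ h₁₃ h₁₄ h₂₃ h₂₄ h₃₄
  tauto

/-- Three orders that form a primitive homogeneous family are obtained from a jointly dense family
by identifying orders up to reversal; `τ` selects the orders that remain. -/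
theorem IsPrimitiveHomogeneous.exists_identification {lt : Fin 3 → M → M → Prop}
    (h : IsPrimitiveHomogeneous lt) :
    ∃ (k : ℕ) (τ : Fin k → Fin 3) (σ : Fin 3 → Fin k) (rev : Fin 3 → Bool),
      0 < k ∧ Function.LeftInverse σ τ ∧ JointlyDense (fun i => lt (τ i)) Set.univ ∧
      ∀ i x y, lt i x y ↔ if rev i = true then lt (τ (σ i)) y x else lt (τ (σ i)) x y := by
  classical
  obtain ⟨J, hJ, hJne, hdet⟩ := h.exists_sign_eq
  have hdet' : ∀ k, ∃ j : J, ∃ c : Bool, (∀ p, IsRealized lt p → p k = (p j ^^ c)) ∧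
      (k ∈ J → k = j) := by
    intro k
    by_cases hk : k ∈ J
    · exact ⟨⟨k, hk⟩, false, by simp, fun _ => rfl⟩
    · obtain ⟨j, hj, c, hc⟩ := hdet k hk
      exact ⟨⟨j, hj⟩, c, hc, fun h' => absurd h' hk⟩
  choose f rev hf hfJ using hdet'
  obtain ⟨m, ⟨e⟩⟩ := Finite.exists_equiv_fin J
  refine ⟨m, fun s => (e.symm s : Fin 3), fun i => e (f i), rev, ?_, ?_, ?_, ?_⟩
  · obtain ⟨j, hj⟩ := hJne
    exact Fin.pos (e ⟨j, hj⟩)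
  · intro s
    have : f (e.symm s : Fin 3) = e.symm s := Subtype.ext (hfJ _ (e.symm s).2).symm
    simp [this]
  · intro lo hi hlh
    obtain ⟨x₀, -⟩ := h.nontrivial
    obtain ⟨z, hz⟩ := hJ (fun j => if hj : j ∈ J then lo (e ⟨j, hj⟩) else x₀)
      (fun j => if hj : j ∈ J then hi (e ⟨j, hj⟩) else x₀) (fun j hj => by
        have := hlh (e ⟨j, hj⟩) (Set.mem_univ _)
        simpa [hj] using this)
    exact ⟨z, fun s _ => by simpa using hz (e.symm s) (e.symm s).2⟩
  · intro i x y
    rcases eq_or_ne x y with rfl | hne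
    · simp [h.irrefl]
    obtain ⟨p, hp⟩ := h.exists_hasType hne
    have h₁ := hp i
    have h₂ := hp (f i)
    have h₁' := h.dir_asymm h₁
    have h₂' := h.dir_asymm h₂
    have h₃ := hf i p hp.realized
    simp only [Equiv.symm_apply_apply]
    rw [h₃] at h₁ h₁'
    revert h₁ h₁' h₂ h₂'
    cases p (f i) <;> cases rev i <;> simp [DirLT] <;> tauto

end Independence

/-! ### Permutation structures as first-order structures -/

section ModelTheory

open FirstOrder FirstOrder.Language

variable {n k : ℕ}

/-- The structure in the language `permLang n` given by `n` binary relations. -/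
@[reducible] def permStructureOf {M : Type*} (lt : Fin n → M → M → Prop) : (permLang n).Structure M where
  funMap f := isEmptyElim f
  RelMap r v := match r, v with
    | PermRel.lt i, v => lt i (v 0) (v 1)

theorem relMap_lt_iff {M : Type*} [(permLang n).Structure M] (i : Fin n) (v : Fin 2 → M) :
    Structure.RelMap (L := permLang n) (n := 2) (PermRel.lt i) v ↔ permLT i (v 0) (v 1) := by
  have : v = ![v 0, v 1] := by ext j; fin_cases j <;> rfl
  rw [permLT, ← this]

theorem IsPermStructure.isLinearFamily {M : Type*} [(permLang n).Structure M]
    (h : IsPermStructure n M) : IsLinearFamily (permLT (n := n) (M := M)) :=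
  ⟨h.irrefl, h.trans, h.total⟩

theorem IsLinearFamily.isPermStructure {M : Type*} [(permLang n).Structure M]
    (h : IsLinearFamily (permLT (n := n) (M := M))) : IsPermStructure n M :=
  ⟨h.irrefl, h.trans, h.total⟩

theorem permLT_map {M N F : Type*} [(permLang n).Structure M] [(permLang n).Structure N]
    [FunLike F M N] [StrongHomClass (permLang n) F M N] (f : F) (i : Fin n) (x y : M) :
    permLT i (f x) (f y) ↔ permLT i x y := by
  have := StrongHomClass.map_rel (L := permLang n) f (n := 2) (PermRel.lt i) ![x, y]
  rwa [relMap_lt_iff, relMap_lt_iff] at this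

/-- An injective map that respects all the orders, as an embedding of structures. -/
def permEmbedding {M N : Type*} [(permLang n).Structure M] [(permLang n).Structure N] (f : M → N)
    (hinj : Function.Injective f) (hf : ∀ (i : Fin n) x y, permLT i (f x) (f y) ↔ permLT i x y) :
    M ↪[permLang n] N where
  toFun := f
  inj' := hinj
  map_fun' g := isEmptyElim g
  map_rel' := by
    rintro _ ⟨i⟩ v
    rw [relMap_lt_iff, relMap_lt_iff]
    exact hf i _ _

/-- A bijection that respects all the orders, as an isomorphism of structures. -/
def permEquiv {M N : Type*} [(permLang n).Structure M] [(permLang n).Structure N] (e : M ≃ N)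
    (he : ∀ (i : Fin n) x y, permLT i (e x) (e y) ↔ permLT i x y) : M ≃[permLang n] N where
  toEquiv := e
  map_fun' g := isEmptyElim g
  map_rel' := by
    rintro _ ⟨i⟩ v
    rw [relMap_lt_iff, relMap_lt_iff]
    exact he i _ _

theorem IsLinearFamily.eq_iff_of_lt_iff {ι M N : Type*} [Nonempty ι] {lt : ι → M → M → Prop}
    {lt' : ι → N → N → Prop} (h : IsLinearFamily lt) (h' : IsLinearFamily lt') {x y : M} {u v : N}
    (hxy : ∀ i, (lt i x y ↔ lt' i u v) ∧ (lt i y x ↔ lt' i v u)) : x = y ↔ u = v := by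
  obtain ⟨i⟩ := ‹Nonempty ι›
  obtain ⟨h₁, h₂⟩ := hxy i
  constructor
  · rintro rfl
    by_contra hne
    rcases h'.total i u v hne with h₃ | h₃
    · exact h.irrefl i x (h₁.2 h₃)
    · exact h.irrefl i x (h₂.2 h₃)
  · rintro rfl
    by_contra hne
    rcases h.total i x y hne with h₃ | h₃
    · exact h'.irrefl i u (h₁.1 h₃)
    · exact h'.irrefl i u (h₂.1 h₃)

/-- For permutation structures, homogeneity in terms of finite tuples agrees with homogeneity in
terms of finitely generated substructures. -/
theorem isUltrahomogeneous_iff [NeZero n] {M : Type*} [(permLang n).Structure M]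
    (hM : IsPermStructure n M) :
    (permLang n).IsUltrahomogeneous M ↔ IsHomogeneousFamily (permLT (n := n) (M := M)) := by
  have hl := hM.isLinearFamily
  constructor
  · intro hu m a b hab
    have heq : ∀ j k, a j = a k ↔ b j = b k := fun j k =>
      hl.eq_iff_of_lt_iff hl fun i => ⟨hab i j k, hab i k j⟩
    let S := Substructure.closure (permLang n) (Set.range a)
    have hS : ∀ x, x ∈ S ↔ ∃ j, a j = x := fun x => by
      simp only [S, Substructure.mem_closure_iff_of_isRelational, Set.mem_range]
    choose g hg using fun x : S => (hS x).1 x.2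
    obtain ⟨e, he⟩ := hu S (Substructure.fg_closure (Set.finite_range a))
      (permEmbedding (fun x => b (g x))
        (fun x y hxy => Subtype.ext (by rw [← hg x, ← hg y]; exact (heq _ _).2 hxy))
        (fun i x y => by
          rw [← hab, hg, hg]
          exact permLT_map S.subtype i x y))
    refine ⟨e.toEquiv, fun i x y => permLT_map e i x y, fun j => ?_⟩
    let x : S := ⟨a j, (hS _).2 ⟨j, rfl⟩⟩
    have := DFunLike.congr_fun he x
    exact this.symm.trans ((heq _ _).1 (hg x))
  · intro hh S hS f
    have : Finite S := hS.finite
    obtain ⟨m, ⟨c⟩⟩ := Finite.exists_equiv_fin S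
    obtain ⟨e, he, hef⟩ := hh m (fun j => (c.symm j : M)) (fun j => f (c.symm j)) (fun i j k => by
      rw [permLT_map f]
      exact permLT_map S.subtype i _ _)
    refine ⟨permEquiv e he, ?_⟩
    ext x
    have := hef (c x)
    simp only [Equiv.symm_apply_apply] at this
    exact this.symm

/-! ### Definable and invariant relations -/

theorem definable_permLT {M : Type*} [(permLang n).Structure M] (i : Fin n) (s t : Fin 2) :
    (∅ : Set M).Definable (permLang n) {x : Fin 2 → M | permLT i (x s) (x t)} := by
  rw [Set.empty_definable_iff]
  refine ⟨Relations.formula₂ (L := permLang n) (PermRel.lt i : (permLang n).Relations 2)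
    (Term.var s) (Term.var t), ?_⟩
  ext x
  exact (Formula.realize_rel₂ (L := permLang n) (M := M) (R := PermRel.lt i) (v := x)
    (t₁ := Term.var s) (t₂ := Term.var t)).symm

/-- In a homogeneous permutation structure, an equivalence relation that is invariant under
automorphisms is definable: it is the union of the diagonal and of finitely many 2-types. -/
theorem definable_of_invariant {M : Type*} [(permLang n).Structure M] (hM : IsPermStructure n M)
    (hh : IsHomogeneousFamily (permLT (n := n) (M := M))) (r : Setoid M)
    (hr : ∀ e : M ≃ M, IsAut (permLT (n := n)) e → ∀ x y, r x y → r (e x) (e y)) :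
    (∅ : Set M).Definable₂ (permLang n) {p : M × M | r p.1 p.2} := by
  have hl := hM.isLinearFamily
  let Q : Set (Fin n → Bool) := {p | ∃ x y, HasType permLT p x y ∧ x ≠ y ∧ r x y}
  have hset : {x : Fin 2 → M | r (x 0) (x 1)} = {x | x 0 = x 1} ∪
      ⋃ p : Q, ({x | x 0 = x 1}ᶜ ∩ ⋂ i : Fin n, {x | DirLT permLT i (p.1 i) (x 0) (x 1)}) := by
    ext x
    simp only [Set.mem_ofPred_eq, Set.mem_union, Set.mem_iUnion, Set.mem_inter_iff,
      Set.mem_compl_iff, Set.mem_iInter]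
    constructor
    · intro hx
      by_cases hne : x 0 = x 1
      · exact Or.inl hne
      · obtain ⟨p, hp⟩ := hl.exists_hasType hne
        exact Or.inr ⟨⟨p, x 0, x 1, hp, hne, hx⟩, hne, hp⟩
    · rintro (hx | ⟨⟨p, u, v, hp, huv, hruv⟩, hne, hx⟩)
      · rw [hx]
      · obtain ⟨e, he, h'⟩ := hh 2 ![u, v] x (fun i j k => by
          have := hl.lt_iff_of_dir (hp i) (hx i)
          fin_cases j <;> fin_cases k <;> simp [hl.irrefl, this])
        rw [← h' 0, ← h' 1]
        exact hr e he _ _ hruv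
  have hdiag : (∅ : Set M).Definable (permLang n) {x : Fin 2 → M | x 0 = x 1} :=
    Set.Definable.diagonal (L := permLang n) (M := M) ∅
  have hdir : ∀ (i : Fin n) (b : Bool),
      (∅ : Set M).Definable (permLang n) {x : Fin 2 → M | DirLT permLT i b (x 0) (x 1)} := by
    intro i b
    cases b
    · exact definable_permLT i 1 0
    · exact definable_permLT i 0 1
  change (∅ : Set M).Definable (permLang n) {x : Fin 2 → M | r (x 0) (x 1)}
  rw [hset]
  exact hdiag.union (Set.definable_iUnion_of_finite fun p =>
    hdiag.compl.inter (Set.definable_iInter_of_finite fun i => hdir i _))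

theorem invariant_of_definable {M : Type*} [(permLang n).Structure M] {r : Setoid M}
    (hr : (∅ : Set M).Definable₂ (permLang n) {p : M × M | r p.1 p.2}) (e : M ≃ M)
    (he : IsAut (permLT (n := n)) e) (x y : M) (hxy : r x y) : r (e x) (e y) := by
  obtain ⟨φ, hφ⟩ := Set.empty_definable_iff.1 hr
  have h₁ : ![x, y] ∈ {x : Fin 2 → M | r (x 0) (x 1)} := hxy
  have h₂ : (fun j => e (![x, y] j)) ∈ {x : Fin 2 → M | r (x 0) (x 1)} := by
    have hφ' : {x : Fin 2 → M | r (x 0) (x 1)} = Set.ofPred φ.Realize := hφ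
    rw [hφ'] at h₁ ⊢
    exact (StrongHomClass.realize_formula (permEquiv e he) φ).2 h₁
  exact h₂

theorem IsPermStructure.isPrimitiveHomogeneous [NeZero n] {M : Type*} [(permLang n).Structure M]
    (hM : IsPermStructure n M) (hnt : Nontrivial M) (hu : (permLang n).IsUltrahomogeneous M)
    (hp : IsPrimitiveStructure (permLang n) M) :
    IsPrimitiveHomogeneous (permLT (n := n) (M := M)) :=
  { hM.isLinearFamily with
    homogeneous := (isUltrahomogeneous_iff hM).1 hu
    primitive := fun r hr =>
      hp r (definable_of_invariant hM ((isUltrahomogeneous_iff hM).1 hu) r hr)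
    nontrivial := hnt.exists_pair_ne
    nonempty_index := ⟨0⟩ }

end ModelTheory

/-! ### Jointly dense families and the generic structure -/

section Generic

open FirstOrder FirstOrder.Language

variable {n k : ℕ}

/-- Finite sets `A < B` in a linear order without endpoints are separated by an open interval. -/
theorem IsLinearFamily.exists_separating_interval {ι N : Type*} {lt : ι → N → N → Prop}
    (h : IsLinearFamily lt) [Nonempty N] (i : ι) (hmax : ∀ x, ∃ y, lt i x y)
    (hmin : ∀ x, ∃ y, lt i y x) {A B : Set N} (hA : A.Finite) (hB : B.Finite)
    (hAB : ∀ a ∈ A, ∀ b ∈ B, lt i a b) :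
    ∃ lo hi, lt i lo hi ∧ (∀ a ∈ A, a = lo ∨ lt i a lo) ∧ ∀ b ∈ B, b = hi ∨ lt i hi b := by
  have h₁ : ∃ lo, ∀ b ∈ B, lt i lo b := by
    induction B, hB using Set.Finite.induction_on with
    | empty => exact ⟨Classical.arbitrary N, by simp⟩
    | @insert c B _ _ ih =>
      obtain ⟨lo, hlo⟩ := ih fun a ha b hb => hAB a ha b (Set.mem_insert_of_mem c hb)
      obtain ⟨c', hc'⟩ := hmin c
      rcases h.dir_total i true lo c with h' | h' | h'
      · exact ⟨lo, by rintro b (rfl | hb); exacts [h', hlo b hb]⟩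
      · exact ⟨c', by rintro b (rfl | hb); exacts [hc', h.trans _ _ _ _ hc' (h' ▸ hlo b hb)]⟩
      · exact ⟨c', by
          rintro b (rfl | hb)
          exacts [hc', h.trans _ _ _ _ hc' (h.trans _ _ _ _ h' (hlo b hb))]⟩
  have h₂ : ∃ lo, (∀ a ∈ A, a = lo ∨ lt i a lo) ∧ ∀ b ∈ B, lt i lo b := by
    induction A, hA using Set.Finite.induction_on with
    | empty => exact h₁.imp fun lo hlo => ⟨by simp, hlo⟩
    | @insert c A _ _ ih =>
      obtain ⟨lo, hlo, hlo'⟩ := ih fun a ha => hAB a (Set.mem_insert_of_mem c ha)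
      rcases h.dir_total i true lo c with h' | h' | h'
      · refine ⟨c, ?_, hAB c (Set.mem_insert c A)⟩
        rintro a (rfl | ha)
        · exact Or.inl rfl
        · rcases hlo a ha with rfl | h''
          · exact Or.inr h'
          · exact Or.inr (h.trans _ _ _ _ h'' h')
      · refine ⟨lo, ?_, hlo'⟩
        rintro a (rfl | ha)
        exacts [Or.inl h'.symm, hlo a ha]
      · refine ⟨lo, ?_, hlo'⟩
        rintro a (rfl | ha)
        exacts [Or.inr h', hlo a ha]
  obtain ⟨lo, hlo, hlo'⟩ := h₂
  have h₃ : ∃ hi, lt i lo hi ∧ ∀ b ∈ B, b = hi ∨ lt i hi b := by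
    clear hAB h₁
    induction B, hB using Set.Finite.induction_on with
    | empty => exact (hmax lo).imp fun hi hhi => ⟨hhi, by simp⟩
    | @insert c B _ _ ih =>
      obtain ⟨hi, hhi, hhi'⟩ := ih fun b hb => hlo' b (Set.mem_insert_of_mem c hb)
      rcases h.dir_total i true hi c with h' | h' | h'
      · refine ⟨hi, hhi, ?_⟩
        rintro b (rfl | hb)
        exacts [Or.inr h', hhi' b hb]
      · refine ⟨hi, hhi, ?_⟩
        rintro b (rfl | hb)
        exacts [Or.inl h'.symm, hhi' b hb]
      · refine ⟨c, hlo' c (Set.mem_insert c B), ?_⟩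
        rintro b (rfl | hb)
        · exact Or.inl rfl
        · rcases hhi' b hb with rfl | h''
          · exact Or.inr h'
          · exact Or.inr (h.trans _ _ _ _ h' h'')
  obtain ⟨hi, hhi, hhi'⟩ := h₃
  exact ⟨lo, hi, hhi, hlo, hhi'⟩

/-- One-point extensions of finite permutation structures can be realized in a jointly dense
family of orders without endpoints. -/
theorem isExtensionPair_of_jointlyDense [NeZero k] {S N : Type*} [(permLang k).Structure S]
    [(permLang k).Structure N] [Nonempty N] (hS : IsPermStructure k S) (hN : IsPermStructure k N)
    (hd : JointlyDense (permLT (n := k) (M := N)) Set.univ)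
    (hmax : ∀ (i : Fin k) (x : N), ∃ y, permLT i x y)
    (hmin : ∀ (i : Fin k) (x : N), ∃ y, permLT i y x) :
    (permLang k).IsExtensionPair S N := by
  classical
  have hSl := hS.isLinearFamily
  have hNl := hN.isLinearFamily
  rw [isExtensionPair_iff_exists_embedding_closure_singleton_sup]
  intro T hT f m
  have : Finite T := hT.finite
  have hf : ∀ (i : Fin k) (x y : T), permLT i (f x) (f y) ↔ permLT i (x : S) (y : S) :=
    fun i x y => (permLT_map f i x y).trans (permLT_map T.subtype i x y).symm
  obtain ⟨z, hz⟩ : ∃ z : N, ∀ (i : Fin k) (x : T), (x : S) ≠ m →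
      (permLT i (x : S) m → permLT i (f x) z) ∧ (permLT i m (x : S) → permLT i z (f x)) := by
    by_cases hm : m ∈ T
    · exact ⟨f ⟨m, hm⟩, fun i x _ => ⟨(hf i x ⟨m, hm⟩).2, (hf i ⟨m, hm⟩ x).2⟩⟩
    have hex : ∀ i : Fin k, ∃ lo hi : N, permLT i lo hi ∧
        (∀ a ∈ f '' {x | permLT i (x : S) m}, a = lo ∨ permLT i a lo) ∧
        ∀ b ∈ f '' {x | permLT i m (x : S)}, b = hi ∨ permLT i hi b := by
      intro i
      refine hNl.exists_separating_interval i (hmax i) (hmin i) (Set.toFinite _)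
        (Set.toFinite _) ?_
      rintro _ ⟨x, hx, rfl⟩ _ ⟨y, hy, rfl⟩
      exact (hf i x y).2 (hSl.trans i _ _ _ hx hy)
    choose lo hi hlh hlo hhi using hex
    obtain ⟨z, hz⟩ := hd lo hi fun i _ => hlh i
    refine ⟨z, fun i x _ => ⟨fun hx => ?_, fun hx => ?_⟩⟩
    · rcases hlo i (f x) ⟨x, hx, rfl⟩ with h' | h'
      · rw [h']; exact (hz i (Set.mem_univ i)).1
      · exact hNl.trans _ _ _ _ h' (hz i (Set.mem_univ i)).1
    · rcases hhi i (f x) ⟨x, hx, rfl⟩ with h' | h'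
      · rw [h']; exact (hz i (Set.mem_univ i)).2
      · exact hNl.trans _ _ _ _ (hz i (Set.mem_univ i)).2 h'
  let U : (permLang k).Substructure S := Substructure.closure (permLang k) {m} ⊔ T
  have hU : ∀ x ∈ U, x ∉ T → x = m := by
    have : ∀ x, x ∈ U ↔ x = m ∨ x ∈ T := fun x => by
      have hUe : U = Substructure.closure (permLang k) ({m} ∪ (T : Set S)) := by
        rw [Substructure.closure_union, Substructure.closure_eq]
      rw [hUe, Substructure.mem_closure_iff_of_isRelational]
      simp
    intro x hx hxT
    exact ((this x).1 hx).resolve_right hxT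
  let g : U → N := fun x => if hx : (x : S) ∈ T then f ⟨x, hx⟩ else z
  have hg : ∀ (i : Fin k) (x y : U), permLT i (x : S) (y : S) → permLT i (g x) (g y) := by
    rintro i ⟨x, hx⟩ ⟨y, hy⟩ hxy
    have hne : x ≠ y := by
      rintro rfl
      exact hSl.irrefl i _ hxy
    by_cases hxT : x ∈ T <;> by_cases hyT : y ∈ T
    · simpa [g, hxT, hyT] using (hf i ⟨x, hxT⟩ ⟨y, hyT⟩).2 hxy
    · obtain rfl := hU y hy hyT
      simpa [g, hxT, hyT] using (hz i ⟨x, hxT⟩ hne).1 hxy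
    · obtain rfl := hU x hx hxT
      simpa [g, hxT, hyT] using (hz i ⟨y, hyT⟩ hne.symm).2 hxy
    · exact absurd ((hU x hx hxT).trans (hU y hy hyT).symm) hne
  have hg' : ∀ (i : Fin k) (x y : U), permLT i (g x) (g y) → permLT i (x : S) (y : S) := by
    intro i x y hxy
    rcases hSl.dir_total i true (x : S) y with h' | h' | h'
    · exact h'
    · rw [Subtype.ext h'] at hxy
      exact absurd hxy (hNl.irrefl i _)
    · exact absurd (hNl.trans _ _ _ _ hxy (hg i y x h')) (hNl.irrefl i _)
  refine ⟨permEmbedding g (fun x y hxy => ?_)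
    fun i x y => ⟨fun h' => (permLT_map U.subtype i x y).1 (hg' i x y h'),
      fun h' => hg i x y ((permLT_map U.subtype i x y).2 h')⟩, ?_⟩
  · by_contra hne
    rcases hSl.total 0 (x : S) y fun e => hne (Subtype.ext e) with h' | h'
    · exact hNl.irrefl 0 _ (hxy ▸ hg 0 x y h')
    · exact hNl.irrefl 0 _ (hxy ▸ hg 0 y x h')
  · ext x
    have : g (Substructure.inclusion le_sup_right x) = f x := by
      simp [g]
    exact this.symm

instance permRel_zero_isEmpty : IsEmpty ((permLang k).Relations 0) :=
  ⟨fun r => nomatch r⟩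

instance permLang_constants_isEmpty : IsEmpty (permLang k).Constants :=
  inferInstanceAs (IsEmpty Empty)

theorem isPermStructure_of_embedding {M N : Type*} [(permLang k).Structure M]
    [(permLang k).Structure N] (f : M ↪[permLang k] N) (hN : IsPermStructure k N) :
    IsPermStructure k M where
  irrefl i x hx := hN.irrefl i _ ((permLT_map f i x x).2 hx)
  trans i x y z hxy hyz := (permLT_map f i x z).1
    (hN.trans i _ _ _ ((permLT_map f i x y).2 hxy) ((permLT_map f i y z).2 hyz))
  total i x y hxy := (hN.total i _ _ (f.injective.ne hxy)).imp
    (permLT_map f i x y).1 (permLT_map f i y x).1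

/-- A countable set with `k` jointly dense linear orders without endpoints is the generic
`k`-dimensional permutation structure. -/
theorem isFraisseLimit_of_jointlyDense [NeZero k] {N : Type u} [Countable N]
    [(permLang k).Structure N] [Nonempty N] (hN : IsPermStructure k N)
    (hd : JointlyDense (permLT (n := k) (M := N)) Set.univ)
    (hmax : ∀ (i : Fin k) (x : N), ∃ y, permLT i x y)
    (hmin : ∀ (i : Fin k) (x : N), ∃ y, permLT i y x) :
    IsFraisseLimit (L := permLang k) (finitePermStructures k) N where
  ultrahomogeneous := (isUltrahomogeneous_iff_IsExtensionPair Structure.cg_of_countable).2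
    (isExtensionPair_of_jointlyDense hN hN hd hmax hmin)
  age := by
    ext S
    constructor
    · rintro ⟨hfg, ⟨f⟩⟩
      exact ⟨hfg.finite, isPermStructure_of_embedding f hN⟩
    · rintro ⟨hfin, hS⟩
      have : Finite S := hfin
      obtain ⟨f, -⟩ := embedding_from_cg Structure.cg_of_countable default
        (isExtensionPair_of_jointlyDense hS hN hd hmax hmin)
      exact ⟨Structure.FG.of_finite, ⟨f⟩⟩

/-! ### Existence of the generic structure -/

/-- There are `k` jointly dense injective real-valued functions on a countable set: the evaluations
of rational polynomials at `k` distinct transcendental numbers. -/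
theorem exists_jointlyDense_eval (k : ℕ) :
    ∃ v : Fin k → Polynomial ℚ → ℝ, (∀ i, Function.Injective (v i)) ∧
      ∀ lo hi : Fin k → ℝ, (∀ i, lo i < hi i) → ∃ f, ∀ i, lo i < v i f ∧ v i f < hi i := by
  have hinf : {x : ℝ | Transcendental ℚ x}.Infinite := by
    intro hfin
    refine Cardinal.not_countable_real ?_
    refine ((Algebraic.countable ℚ ℝ).union hfin.countable).mono fun x _ => ?_
    by_cases hx : IsAlgebraic ℚ x
    · exact Or.inl hx
    · exact Or.inr hx
  let t : Fin k → ℝ := fun i => hinf.natEmbedding _ i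
  have ht : ∀ i, Transcendental ℚ (t i) := fun i => (hinf.natEmbedding _ i).2
  have htinj : Function.Injective t := fun i j hij =>
    Fin.ext ((hinf.natEmbedding _).injective (Subtype.ext hij))
  refine ⟨fun i f => Polynomial.aeval (t i) f, fun i => transcendental_iff_injective.1 (ht i),
    fun lo hi hlh => ?_⟩
  -- The Vandermonde matrix maps coefficient vectors onto vectors of values.
  have hdet : IsUnit (Matrix.vandermonde t) := by
    rw [Matrix.isUnit_iff_isUnit_det, isUnit_iff_ne_zero, Matrix.det_vandermonde_ne_zero_iff]
    exact htinj
  have hsurj := (Matrix.mulVec_surjective_iff_isUnit (A := Matrix.vandermonde t)).2 hdet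
  have hcont : Continuous (Matrix.vandermonde t).mulVec :=
    Continuous.matrix_mulVec continuous_const continuous_id
  have hdense : DenseRange (Pi.map fun (_ : Fin k) (q : ℚ) => (q : ℝ)) :=
    DenseRange.piMap fun _ => Rat.denseRange_cast
  have hopen : IsOpen (Set.univ.pi fun i => Set.Ioo (lo i) (hi i)) :=
    isOpen_set_pi Set.finite_univ fun i _ => isOpen_Ioo
  obtain ⟨c, hc⟩ := (hsurj.denseRange.comp hdense hcont).exists_mem_open hopen
    ⟨fun i => (lo i + hi i) / 2, fun i _ => ⟨by linarith [hlh i], by linarith [hlh i]⟩⟩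
  refine ⟨∑ j : Fin k, Polynomial.monomial j (c j), fun i => ?_⟩
  have heval : Polynomial.aeval (t i) (∑ j : Fin k, Polynomial.monomial (j : ℕ) (c j)) =
      (Matrix.vandermonde t).mulVec (Pi.map (fun _ (q : ℚ) => (q : ℝ)) c) i := by
    simp [Matrix.mulVec, dotProduct, Matrix.vandermonde_apply, Polynomial.aeval_monomial, mul_comm]
  beta_reduce
  rw [heval]
  exact hc i (Set.mem_univ i)

theorem exists_isFraisseLimit (k : ℕ) [NeZero k] :
    ∃ (N : Type u) (_ : Countable N) (_ : (permLang k).Structure N),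
      IsFraisseLimit (L := permLang k) (finitePermStructures k) N := by
  obtain ⟨v, hinj, hv⟩ := exists_jointlyDense_eval k
  let N := ULift.{u} (Polynomial ℚ)
  have : Countable (Polynomial ℚ) := by
    rw [← Cardinal.mk_le_aleph0_iff]
    simpa only [Cardinal.mkRat, max_self] using Polynomial.cardinalMk_le_max (R := ℚ)
  let str : (permLang k).Structure N :=
    permStructureOf fun i x y => v i x.down < v i y.down
  refine ⟨N, inferInstance, str, isFraisseLimit_of_jointlyDense ?_ ?_ ?_ ?_⟩
  · refine ⟨fun i x => ?_, fun i x y z => ?_, fun i x y hxy => ?_⟩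
    · exact lt_irrefl (v i x.down)
    · exact lt_trans
    · exact lt_or_gt_of_ne fun e => hxy (ULift.ext _ _ (hinj i e))
  · intro lo hi hlh
    obtain ⟨f, hf⟩ := hv (fun i => v i (lo i).down) (fun i => v i (hi i).down)
      fun i => hlh i (Set.mem_univ i)
    exact ⟨ULift.up f, fun i _ => hf i⟩
  · intro i x
    obtain ⟨f, hf⟩ := hv (fun j => v j x.down) (fun j => v j x.down + 1) fun j => by simp
    exact ⟨ULift.up f, (hf i).1⟩
  · intro i x
    obtain ⟨f, hf⟩ := hv (fun j => v j x.down - 1) (fun j => v j x.down) fun j => by simp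
    exact ⟨ULift.up f, (hf i).2⟩

end Generic

/-! ### Properties of the generic structure and of its identifications -/

section Identification

open FirstOrder FirstOrder.Language

variable {k : ℕ}

section FraisseLimit

variable {N : Type u} [Countable N] [(permLang k).Structure N]

theorem isPermStructure_of_isFraisseLimit
    (h : IsFraisseLimit (L := permLang k) (finitePermStructures k) N) : IsPermStructure k N := by
  have key : ∀ x y z : N, ∃ S : (permLang k).Substructure N, IsPermStructure k S ∧ x ∈ S ∧ y ∈ S ∧
      z ∈ S := by
    intro x y z
    let S := Substructure.closure (permLang k) ({x, y, z} : Set N)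
    have hS : ({x, y, z} : Set N) ⊆ S := Substructure.subset_closure
    have hmem := age.fg_substructure (Substructure.fg_closure (L := permLang k)
      (Set.toFinite ({x, y, z} : Set N)))
    rw [h.age] at hmem
    exact ⟨S, hmem.2, hS (by simp), hS (by simp), hS (by simp)⟩
  refine ⟨fun i x hx => ?_, fun i x y z hxy hyz => ?_, fun i x y hxy => ?_⟩
  · obtain ⟨S, hS, hxS, -⟩ := key x x x
    exact hS.irrefl i ⟨x, hxS⟩ ((permLT_map S.subtype i _ _).1 hx)
  · obtain ⟨S, hS, hxS, hyS, hzS⟩ := key x y z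
    have e : ∀ s t : S, permLT i (s : N) (t : N) ↔ permLT i s t := permLT_map S.subtype i
    exact (e ⟨x, hxS⟩ ⟨z, hzS⟩).2 (hS.trans i _ ⟨y, hyS⟩ _
      ((e ⟨x, hxS⟩ ⟨y, hyS⟩).1 hxy) ((e ⟨y, hyS⟩ ⟨z, hzS⟩).1 hyz))
  · obtain ⟨S, hS, hxS, hyS, -⟩ := key x y y
    exact (hS.total i ⟨x, hxS⟩ ⟨y, hyS⟩ fun e => hxy (congrArg Subtype.val e)).imp
      (permLT_map S.subtype i _ _).2 (permLT_map S.subtype i _ _).2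

/-- The generic structure contains every finite configuration of points, prescribed here by the
positions `g i s` of its points `s` in the `i`-th order. -/
theorem exists_tuple_of_isFraisseLimit
    (h : IsFraisseLimit (L := permLang k) (finitePermStructures k) N) {m : ℕ}
    (g : Fin k → Fin m → ℤ) (hg : ∀ i, Function.Injective (g i)) :
    ∃ a : Fin m → N, Function.Injective a ∧ ∀ i s t, permLT i (a s) (a t) ↔ g i s < g i t := by
  let S := ULift.{u} (Fin m)
  let str : (permLang k).Structure S := permStructureOf fun i x y => g i x.down < g i y.down
  have hmem : (⟨S, str⟩ : CategoryTheory.Bundled (permLang k).Structure) ∈ (permLang k).age N := by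
    rw [h.age]
    refine ⟨inferInstanceAs (Finite S), ⟨fun i x => ?_, fun i x y z => ?_, fun i x y hxy => ?_⟩⟩
    · exact lt_irrefl (g i x.down)
    · exact lt_trans
    · exact lt_or_gt_of_ne fun e => hxy (ULift.ext _ _ (hg i e))
  obtain ⟨-, ⟨f⟩⟩ := hmem
  have hf : ∀ i (x y : S), permLT i (f x) (f y) ↔ g i x.down < g i y.down :=
    fun i x y => permLT_map f i x y
  exact ⟨fun s => f ⟨s⟩, fun s t hst => congrArg ULift.down (f.injective hst),
    fun i s t => hf i ⟨s⟩ ⟨t⟩⟩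

/-- In the generic structure, an invariant equivalence relation that relates some distinct `x`, `y`
relates all `u`, `v`: there is a point `z` such that `(u, z)` and `(v, z)` both have the type of
`(x, y)`. -/
theorem eq_bot_or_eq_top_of_isFraisseLimit [NeZero k]
    (h : IsFraisseLimit (L := permLang k) (finitePermStructures k) N) (r : Setoid N)
    (hr : ∀ e : N ≃ N, IsAut (permLT (n := k)) e → ∀ x y, r x y → r (e x) (e y)) :
    r = ⊥ ∨ r = ⊤ := by
  have hN := isPermStructure_of_isFraisseLimit h
  have hl := hN.isLinearFamily
  have hh := (isUltrahomogeneous_iff hN).1 h.ultrahomogeneous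
  have hmove : ∀ {p : Fin k → Bool} {x y x' y' : N}, HasType permLT p x y →
      HasType permLT p x' y' → ∃ e : N ≃ N, IsAut (permLT (n := k)) e ∧ e x = x' ∧ e y = y' := by
    intro p x y x' y' h₁ h₂
    obtain ⟨e, he, h'⟩ := hh 2 ![x, y] ![x', y'] (fun i j l => by
      have := hl.lt_iff_of_dir (h₁ i) (h₂ i)
      fin_cases j <;> fin_cases l <;> simp [hl.irrefl, this])
    exact ⟨e, he, h' 0, h' 1⟩
  by_cases hbot : ∀ x y, r x y → x = y
  · left
    ext x y
    exact ⟨hbot x y, fun e => e ▸ r.refl x⟩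
  push Not at hbot
  obtain ⟨x, y, hxy, hne⟩ := hbot
  right
  ext u v
  refine ⟨fun _ => trivial, fun _ => ?_⟩
  rcases eq_or_ne u v with rfl | huv
  · exact r.refl u
  obtain ⟨p, hp⟩ := hl.exists_hasType hne
  obtain ⟨q, hq⟩ := hl.exists_hasType huv
  obtain ⟨a, -, ha⟩ := exists_tuple_of_isFraisseLimit h
    (fun i => ![0, if q i then 1 else -1, if p i then 2 else -2]) (fun i s t => by
      cases q i <;> cases p i <;> fin_cases s <;> fin_cases t <;> simp)
  have hq' : HasType permLT q (a 0) (a 1) := fun i => by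
    cases hqi : q i <;> simp [DirLT, ha, hqi]
  have hp₁ : HasType permLT p (a 0) (a 2) := fun i => by
    cases hpi : p i <;> simp [DirLT, ha, hpi]
  have hp₂ : HasType permLT p (a 1) (a 2) := fun i => by
    cases hpi : p i <;> cases hqi : q i <;> simp [DirLT, ha, hpi, hqi]
  have hrel : ∀ {x' y' : N}, HasType permLT p x' y' → r x' y' := fun h' => by
    obtain ⟨e, he, rfl, rfl⟩ := hmove hp h'
    exact hr e he _ _ hxy
  obtain ⟨e, he, rfl, rfl⟩ := hmove hq' hq
  exact hr e he _ _ (r.trans (hrel hp₁) (r.symm (hrel hp₂)))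

end FraisseLimit

section Transfer

variable {ι κ M : Type*} {lt : ι → M → M → Prop} {lt' : κ → M → M → Prop} {σ : ι → κ}
  {rev : ι → Bool}

theorem dir_of_identification
    (hσ : ∀ i x y, lt i x y ↔ if rev i = true then lt' (σ i) y x else lt' (σ i) x y)
    (i : ι) (x y : M) : lt' (σ i) x y ↔ if rev i = true then lt i y x else lt i x y := by
  rw [hσ, hσ]
  cases rev i <;> simp

theorem IsLinearFamily.of_identification
    (hσ : ∀ i x y, lt i x y ↔ if rev i = true then lt' (σ i) y x else lt' (σ i) x y)
    (h : IsLinearFamily lt') : IsLinearFamily lt where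
  irrefl i x := by simp [hσ, h.irrefl]
  trans i x y z := by
    rw [hσ, hσ, hσ]
    cases rev i
    · exact h.trans _ x y z
    · exact fun h₁ h₂ => h.trans _ z y x h₂ h₁
  total i x y hne := by
    rw [hσ, hσ]
    cases rev i
    · exact h.total _ x y hne
    · exact h.total _ y x hne.symm

theorem isAut_iff_of_identification (hsurj : Function.Surjective σ)
    (hσ : ∀ i x y, lt i x y ↔ if rev i = true then lt' (σ i) y x else lt' (σ i) x y)
    (e : M ≃ M) : IsAut lt e ↔ IsAut lt' e := by
  constructor
  · intro he j x y
    obtain ⟨i, rfl⟩ := hsurj j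
    rw [dir_of_identification hσ, dir_of_identification hσ, he, he]
  · intro he i x y
    rw [hσ, hσ, he, he]

theorem IsHomogeneousFamily.of_identification (hsurj : Function.Surjective σ)
    (hσ : ∀ i x y, lt i x y ↔ if rev i = true then lt' (σ i) y x else lt' (σ i) x y)
    (h : IsHomogeneousFamily lt') : IsHomogeneousFamily lt := by
  intro m a b hab
  obtain ⟨e, he, h'⟩ := h m a b fun j s t => by
    obtain ⟨i, rfl⟩ := hsurj j
    rw [dir_of_identification hσ, dir_of_identification hσ, hab, hab]
  exact ⟨e, (isAut_iff_of_identification hsurj hσ e).2 he, h'⟩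

end Transfer

theorem IsPrimitiveHomogeneous.isGenericUpToIdentification {Γ : Type u} [Countable Γ]
    [(permLang 3).Structure Γ] (h : IsPrimitiveHomogeneous (permLT (n := 3) (M := Γ))) :
    ∃ (k : ℕ) (σ : Fin 3 → Fin k) (rev : Fin 3 → Bool),
      Function.Surjective σ ∧ IsGenericUpToIdentification σ rev Γ := by
  obtain ⟨k, τ, σ, rev, hk, hinv, hd, hσ⟩ := h.exists_identification
  have : NeZero k := ⟨hk.ne'⟩
  obtain ⟨x₀, -⟩ := h.nontrivial
  have : Nonempty Γ := ⟨x₀⟩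
  let str : (permLang k).Structure Γ := permStructureOf fun i => permLT (τ i)
  refine ⟨k, σ, rev, hinv.surjective, str, isFraisseLimit_of_jointlyDense
    ⟨fun i => h.irrefl (τ i), fun i => h.trans (τ i), fun i => h.total (τ i)⟩ hd
    (fun i x => h.exists_dir (τ i) true x) (fun i x => h.exists_dir (τ i) false x),
    fun i x y => hσ i x y⟩

theorem IsGenericUpToIdentification.isPrimitiveHomogeneous {n : ℕ} [NeZero n] {Γ : Type u}
    [Countable Γ] [(permLang n).Structure Γ] {σ : Fin n → Fin k} {rev : Fin n → Bool}
    (hsurj : Function.Surjective σ) (h : IsGenericUpToIdentification σ rev Γ) :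
    IsPermStructure n Γ ∧ Nontrivial Γ ∧ (permLang n).IsUltrahomogeneous Γ ∧
      IsPrimitiveStructure (permLang n) Γ := by
  have : NeZero k := ⟨(Fin.pos (σ 0)).ne'⟩
  obtain ⟨str, hF, hσ⟩ := h
  have hN := isPermStructure_of_isFraisseLimit hF
  have hΓ := (IsLinearFamily.of_identification hσ hN.isLinearFamily).isPermStructure
  refine ⟨hΓ, ?_, ?_, ?_⟩
  · obtain ⟨a, ha, -⟩ := exists_tuple_of_isFraisseLimit hF (m := 2) (fun _ s => (s : ℤ))
      (fun _ s t hst => by simpa [Fin.ext_iff] using hst)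
    exact ⟨a 0, a 1, ha.ne (by decide)⟩
  · exact (isUltrahomogeneous_iff hΓ).2 (IsHomogeneousFamily.of_identification hsurj hσ
      ((isUltrahomogeneous_iff hN).1 hF.ultrahomogeneous))
  · intro r hr
    exact eq_bot_or_eq_top_of_isFraisseLimit hF r fun e he =>
      invariant_of_definable hr e ((isAut_iff_of_identification hsurj hσ e).2 he)

theorem exists_isGenericUpToIdentification {n : ℕ} [NeZero n] (σ : Fin n → Fin k)
    (rev : Fin n → Bool) : ∃ (Γ : Type u) (_ : Countable Γ) (_ : (permLang n).Structure Γ),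
      IsGenericUpToIdentification σ rev Γ := by
  have : NeZero k := ⟨(Fin.pos (σ 0)).ne'⟩
  obtain ⟨Γ, hc, str, hF⟩ := exists_isFraisseLimit.{u} k
  let str' : (permLang n).Structure Γ := permStructureOf fun i x y =>
    if rev i = true then permLT (σ i) y x else permLT (σ i) x y
  exact ⟨Γ, hc, str', str, hF, fun _ _ _ => Iff.rfl⟩

end Identification

theorem theorem3p1 :
    (∀ (Γ : Type u) [Countable Γ] [(permLang 3).Structure Γ],
      (IsPermStructure 3 Γ ∧ Nontrivial Γ ∧ (permLang 3).IsUltrahomogeneous Γ ∧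
          IsPrimitiveStructure (permLang 3) Γ) ↔
        ∃ (k : ℕ) (σ : Fin 3 → Fin k) (rev : Fin 3 → Bool),
          Function.Surjective σ ∧ IsGenericUpToIdentification σ rev Γ) ∧
    (∀ (k : ℕ) (σ : Fin 3 → Fin k) (rev : Fin 3 → Bool), Function.Surjective σ →
      ∃ (Γ : Type u) (_ : Countable Γ) (_ : (permLang 3).Structure Γ),
        IsGenericUpToIdentification σ rev Γ) := by
  refine ⟨fun Γ _ _ => ⟨?_, ?_⟩, fun k σ rev _ => exists_isGenericUpToIdentification σ rev⟩
  · rintro ⟨hΓ, hnt, hu, hp⟩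
    exact (hΓ.isPrimitiveHomogeneous hnt hu hp).isGenericUpToIdentification
  · rintro ⟨k, σ, rev, hsurj, h⟩
    exact h.isPrimitiveHomogeneous hsurj
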